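/- Let $k$ be a field and let $H$ be a finite-dimensional Hopf algebra over $k$ with comultiplication $h\mapsto h_{(1)}\otimes h_{(2)}$, counit $\varepsilon$ and antipode $S$. Fix a non-zero right cointegral $\lambda_H:H\to k$ (that is, $\lambda_H(h_{(1)})h_{(2)}=\lambda_H(h)1$ for all $h\in H$) and a non-zero left integral $\Lambda\in H$ (that is, $h\Lambda=\varepsilon(h)\Lambda$ for all $h \in H$). Let $g_H\in H$ be the distinguished grouplike element, i.e. the unique grouplike element such that $h_{(1)}\lambda_H(h_{(2)})=\lambda_H(h)g_H$ for all $h\in H$, let $\alpha_H:H\to k$ be the left modular function, i.e. the unique algebra map such that $\Lambda h=\alpha_H(h)\Lambda$ for all $h\in H$, and put $\overline{\alpha}_H=\alpha_H\circ S$. Let $A$ be a finite-dimensional left $H$-comodule algebra with coaction $a\mapsto a_{(-1)}\otimes a_{(0)}$, that is, an algebra in the tensor category $\mathcal{C}$ of finite-dimensional left $H$-comodules. For $a\in A$ and $f\in H^*$ write $a\leftharpoonup f=\langle f,a_{(-1)}\rangle a_{(0)}$. Let ${}_A\mathcal{C}_A$ be the category of $A$-bimodules in $\mathcal{C}$ (finite-dimensional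 relative Hopf bimodules), a monoidal category with product $\otimes_A$ and unit object $A$. The modular object of ${}_A\mathcal{C}_A$ is the value at the unit object of the Nakayama functor $$\mathbb{N}(M)=\int^{X\in{}_A\mathcal{C}_A}\mathrm{Hom}(M,X)^*\odot X ,$$ where the integral sign denotes a coend and $V\odot X$ is the copower of $X$ by the finite-dimensional vector space $V$. Suppose that there are a grouplike element $g_A\in H$ and a non-degenerate $g_A$-cointegral $\lambda_A$ on $A$, that is, a linear map $\lambda_A:A\to k$ such that $a_{(-1)}\lambda_A(a_{(0)})=\lambda_A(a)g_A$ for all $a\in A$ and such that $a\mapsto\lambda_A(a\,\cdot\,)$ is a bijection $A\to A^*$. Let $\nu_A$ be the Nakayama automorphism of $A$ with respect to $\lambda_A$, i.e. the unique algebra automorphism such that $\lambda_A(ba)=\lambda_A(\nu_A(a)b)$ for all $a,b\in A$. Then the following data make the vector space $\boldsymbol{\alpha}:=A$ an object of ${}_A\mathcal{C}_A$, and this object is (up to isomorphism) the modular object of ${}_A\mathcal{C}_A$: the left $H$-coaction is $$x\mapsto g_A^{-2}g_H\,x_{(-1)}\otimes x_{(0)}\qquad(x\in\boldsymbol{\alpha}),$$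 and the left and right actions of $A$ are $$a\triangleright x\triangleleft b=\nu_A^2(a\leftharpoonup\overline{\alpha}_H)\cdot x\cdot b\qquad(a,b\in A,\ x\in\boldsymbol{\alpha}).$$ -/

import Mathlib

open CategoryTheory TensorProduct Opposite

universe u

noncomputable section

/-- A left coaction of the coalgebra `H` on the vector space `M`: a coassociative and counital
linear map `δ : M → H ⊗ M`, `m ↦ m₍₋₁₎ ⊗ m₍₀₎`. -/
structure IsLeftCoaction {k H M : Type u} [Field k] [Ring H] [HopfAlgebra k H]
    [AddCommGroup M] [Module k M] (δ : M →ₗ[k] H ⊗[k] M) : Prop where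
  coassoc : ∀ m : M, δ.lTensor H (δ m) =
    TensorProduct.assoc k H H M ((Coalgebra.comul (R := k) (A := H)).rTensor M (δ m))
  counit : ∀ m : M, (Coalgebra.counit (R := k) (A := H)).rTensor M (δ m) = 1 ⊗ₜ[k] m

/-- The structure of a left `H`-comodule algebra on the algebra `A`, that is, of an algebra in the
monoidal category of left `H`-comodules: a left coaction which is an algebra map. -/
structure LeftComoduleAlgebra (k H A : Type u) [Field k] [Ring H] [HopfAlgebra k H]
    [Ring A] [Algebra k A] where
  coact : A →ₐ[k] H ⊗[k] A
  isLeftCoaction : IsLeftCoaction coact.toLinearMap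

/-- For a coaction `δ` on `M` and a linear form `f` on `H`, the map
`m ↦ m ↼ f = ⟨f, m₍₋₁₎⟩ m₍₀₎`. -/
def hitRight {k H M : Type u} [Field k] [Ring H] [HopfAlgebra k H] [AddCommGroup M] [Module k M]
    (δ : M →ₗ[k] H ⊗[k] M) (f : H →ₗ[k] k) : M →ₗ[k] M :=
  (TensorProduct.lid k M).toLinearMap ∘ₗ f.rTensor M ∘ₗ δ

/-! ### Integrals and cointegrals -/

section Integrals

variable {k H A : Type u} [Field k] [Ring H] [HopfAlgebra k H] [Ring A] [Algebra k A]

/-- A right cointegral on `H`: `λ(h₍₁₎) h₍₂₎ = λ(h) 1` for all `h`. -/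
def IsRightCointegral (lam : H →ₗ[k] k) : Prop :=
  ∀ h : H, TensorProduct.lid k H (lam.rTensor H (Coalgebra.comul (R := k) h)) = lam h • (1 : H)

/-- A left integral in `H`: `h Λ = ε(h) Λ` for all `h`. -/
def IsLeftIntegral (L : H) : Prop :=
  ∀ h : H, h * L = Coalgebra.counit (R := k) h • L

/-- `g` is the distinguished grouplike element, with respect to the right cointegral `λ`:
`h₍₁₎ λ(h₍₂₎) = λ(h) g` for all `h`. -/
def IsDistinguishedGrouplike (lam : H →ₗ[k] k) (g : GroupLike k H) : Prop :=
  ∀ h : H, TensorProduct.rid k H (lam.lTensor H (Coalgebra.comul (R := k) h)) = lam h • (g : H)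

/-- `α` is the left modular function, with respect to the left integral `Λ`:
`Λ h = α(h) Λ` for all `h`. -/
def IsLeftModularFunction (L : H) (α : H →ₐ[k] k) : Prop :=
  ∀ h : H, L * h = α h • L

/-- A `g`-cointegral on the left `H`-comodule algebra `A`: a linear form `λ` such that
`a₍₋₁₎ λ(a₍₀₎) = λ(a) g` for all `a`. -/
def IsGCointegral (δ : LeftComoduleAlgebra k H A) (g : GroupLike k H) (lam : A →ₗ[k] k) : Prop :=
  ∀ a : A, TensorProduct.rid k H (lam.lTensor H (δ.coact a)) = lam a • (g : H)

/-- A Frobenius trace on `A`: a linear form `λ` such that `a ↦ λ(a -)` is a bijection from `A` to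
its dual space. -/
def IsFrobeniusTrace (lam : A →ₗ[k] k) : Prop :=
  Function.Bijective fun a : A => (lam ∘ₗ LinearMap.mulLeft k a : Module.Dual k A)

/-- `ν` is the Nakayama automorphism of `A` with respect to the Frobenius trace `λ`:
`λ(b a) = λ(ν(a) b)` for all `a` and `b`. -/
def IsNakayamaAutomorphism (lam : A →ₗ[k] k) (ν : A ≃ₐ[k] A) : Prop :=
  ∀ a b : A, lam (b * a) = lam (ν a * b)

end Integrals

/-! ### Relative Hopf bimodules -/

/-- The structure of a relative Hopf bimodule on the vector space `M`, that is, of an `A`-bimodule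
in the category of left `H`-comodules: commuting unital associative left and right actions of `A`
and a left coaction of `H` such that
`(a m)₍₋₁₎ ⊗ (a m)₍₀₎ = a₍₋₁₎ m₍₋₁₎ ⊗ a₍₀₎ m₍₀₎` and
`(m b)₍₋₁₎ ⊗ (m b)₍₀₎ = m₍₋₁₎ b₍₋₁₎ ⊗ m₍₀₎ b₍₀₎`. -/
structure HopfBimodStr {k H A : Type u} [Field k] [Ring H] [HopfAlgebra k H] [Ring A] [Algebra k A]
    (δ : LeftComoduleAlgebra k H A) (M : Type u) [AddCommGroup M] [Module k M] where
  coact : M →ₗ[k] H ⊗[k] M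
  lact : A →ₗ[k] M →ₗ[k] M
  ract : M →ₗ[k] A →ₗ[k] M
  isLeftCoaction : IsLeftCoaction coact
  one_lact : ∀ m : M, lact 1 m = m
  mul_lact : ∀ (a b : A) (m : M), lact (a * b) m = lact a (lact b m)
  ract_one : ∀ m : M, ract m 1 = m
  ract_mul : ∀ (m : M) (a b : A), ract m (a * b) = ract (ract m a) b
  lact_ract : ∀ (a : A) (m : M) (b : A), ract (lact a m) b = lact a (ract m b)
  coact_lact : ∀ (a : A) (m : M),
    coact (lact a m) = TensorProduct.map₂ (LinearMap.mul k H) lact (δ.coact a) (coact m)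
  coact_ract : ∀ (m : M) (b : A),
    coact (ract m b) = TensorProduct.map₂ (LinearMap.mul k H) ract (coact m) (δ.coact b)

/-- A finite-dimensional relative Hopf bimodule. -/
structure HopfBimod {k H A : Type u} [Field k] [Ring H] [HopfAlgebra k H] [Ring A] [Algebra k A]
    (δ : LeftComoduleAlgebra k H A) where
  carrier : Type u
  [addCommGroup : AddCommGroup carrier]
  [module : Module k carrier]
  [finite : Module.Finite k carrier]
  str : HopfBimodStr δ carrier

namespace HopfBimod

variable {k H A : Type u} [Field k] [Ring H] [HopfAlgebra k H] [Ring A] [Algebra k A]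
  {δ : LeftComoduleAlgebra k H A}

instance : CoeSort (HopfBimod δ) (Type u) := ⟨HopfBimod.carrier⟩

instance (X : HopfBimod δ) : AddCommGroup X := X.addCommGroup

instance (X : HopfBimod δ) : Module k X := X.module

instance (X : HopfBimod δ) : Module.Finite k X := X.finite

/-- The space of morphisms: the linear maps that commute with both actions and with the
coactions. -/
def homs (X Y : HopfBimod δ) : Submodule k (X →ₗ[k] Y) where
  carrier := {f |
    (∀ a x, f (X.str.lact a x) = Y.str.lact a (f x)) ∧
    (∀ x a, f (X.str.ract x a) = Y.str.ract (f x) a) ∧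
    (∀ x, Y.str.coact (f x) = f.lTensor H (X.str.coact x))}
  add_mem' := by
    rintro f g ⟨h1, h2, h3⟩ ⟨h1', h2', h3'⟩
    refine ⟨fun a x => ?_, fun x a => ?_, fun x => ?_⟩
    · simp [h1, h1']
    · simp [h2, h2']
    · simp [h3, h3', LinearMap.lTensor_add]
  zero_mem' := by
    refine ⟨fun a x => ?_, fun x a => ?_, fun x => ?_⟩ <;> simp
  smul_mem' := by
    rintro c f ⟨h1, h2, h3⟩
    refine ⟨fun a x => ?_, fun x a => ?_, fun x => ?_⟩
    · simp [h1]
    · simp [h2]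
    · simp [h3, LinearMap.lTensor_smul]

/-- The category `_A C_A` of finite-dimensional relative Hopf bimodules. -/
instance : Category (HopfBimod δ) where
  Hom X Y := homs X Y
  id X := ⟨LinearMap.id, fun _ _ => rfl, fun _ _ => rfl, fun x => by simp⟩
  comp f g := ⟨g.1 ∘ₗ f.1,
    fun a x => by simp [f.2.1, g.2.1],
    fun x a => by simp [f.2.2.1, g.2.2.1],
    fun x => by simp [f.2.2.2, g.2.2.2, LinearMap.lTensor_comp]⟩

instance (X Y : HopfBimod δ) : AddCommGroup (X ⟶ Y) := inferInstanceAs (AddCommGroup (homs X Y))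

instance (X Y : HopfBimod δ) : Module k (X ⟶ Y) := inferInstanceAs (Module k (homs X Y))

instance (X Y : HopfBimod δ) : Module.Finite k (X ⟶ Y) :=
  inferInstanceAs (Module.Finite k (homs X Y))

/-- The linear map underlying a morphism. -/
def toLin {X Y : HopfBimod δ} (f : X ⟶ Y) : X →ₗ[k] Y := f.1

@[ext] theorem hom_ext {X Y : HopfBimod δ} {f g : X ⟶ Y} (h : toLin f = toLin g) : f = g :=
  Subtype.ext h

@[simp] theorem toLin_id (X : HopfBimod δ) : toLin (𝟙 X) = LinearMap.id := rfl

@[simp] theorem toLin_comp {X Y Z : HopfBimod δ} (f : X ⟶ Y) (g : Y ⟶ Z) :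
    toLin (f ≫ g) = toLin g ∘ₗ toLin f := rfl

@[simp] theorem toLin_add {X Y : HopfBimod δ} (f g : X ⟶ Y) :
    toLin (f + g) = toLin f + toLin g := rfl

@[simp] theorem toLin_smul {X Y : HopfBimod δ} (c : k) (f : X ⟶ Y) :
    toLin (c • f) = c • toLin f := rfl

instance : Preadditive (HopfBimod δ) where
  homGroup X Y := inferInstance
  add_comp X Y Z f g h := by ext1; simp [LinearMap.comp_add]
  comp_add X Y Z f g h := by ext1; simp [LinearMap.add_comp]

instance : Linear k (HopfBimod δ) where
  homModule X Y := inferInstance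
  smul_comp X Y Z c f g := by ext1; simp [LinearMap.comp_smul]
  comp_smul X Y Z f c g := by ext1; simp [LinearMap.smul_comp]

/-- Postcomposition `Hom(M, X) → Hom(M, Y)`. -/
def postcomp (M : HopfBimod δ) {X Y : HopfBimod δ} (f : X ⟶ Y) : (M ⟶ X) →ₗ[k] (M ⟶ Y) :=
  Linear.rightComp k M f

theorem leftComm_tmul (H : Type u) [Ring H] [Algebra k H] {V X : Type u} [AddCommGroup V]
    [Module k V] [AddCommGroup X] [Module k X] (v : V) (t : H ⊗[k] X) :
    TensorProduct.leftComm k V H X (v ⊗ₜ t) = (TensorProduct.mk k V X v).lTensor H t := by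
  induction t with
  | zero => simp
  | tmul h x => simp
  | add s t hs ht => simp [tmul_add, hs, ht]

theorem map₂_lTensor {X Y B : Type u} [AddCommGroup X] [Module k X] [AddCommGroup Y] [Module k Y]
    [AddCommGroup B] [Module k B] (f : X →ₗ[k] Y) (l : B →ₗ[k] X →ₗ[k] X)
    (l' : B →ₗ[k] Y →ₗ[k] Y) (h : ∀ b x, f (l b x) = l' b (f x)) (s : H ⊗[k] B) (t : H ⊗[k] X) :
    f.lTensor H (TensorProduct.map₂ (LinearMap.mul k H) l s t) =
      TensorProduct.map₂ (LinearMap.mul k H) l' s (f.lTensor H t) := by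
  induction s with
  | zero => simp
  | add s s' hs hs' => simp [hs, hs']
  | tmul p b =>
    induction t with
    | zero => simp
    | add t t' ht ht' => simp only [map_add, ht, ht']
    | tmul q x => simp [h]

theorem map₂_lTensor' {X Y B : Type u} [AddCommGroup X] [Module k X] [AddCommGroup Y] [Module k Y]
    [AddCommGroup B] [Module k B] (f : X →ₗ[k] Y) (r : X →ₗ[k] B →ₗ[k] X)
    (r' : Y →ₗ[k] B →ₗ[k] Y) (h : ∀ x b, f (r x b) = r' (f x) b) (t : H ⊗[k] X) (s : H ⊗[k] B) :
    f.lTensor H (TensorProduct.map₂ (LinearMap.mul k H) r t s) =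
      TensorProduct.map₂ (LinearMap.mul k H) r' (f.lTensor H t) s := by
  induction s with
  | zero => simp
  | add s s' hs hs' => simp [hs, hs']
  | tmul p b =>
    induction t with
    | zero => simp
    | add t t' ht ht' => simp only [map_add, ht, ht', LinearMap.add_apply]
    | tmul q x => simp [h]

/-- The copower `V ⊙ X` of a finite-dimensional vector space `V` with a relative Hopf bimodule
`X`: the space `V ⊗ X` with the structure of the factor `X`. Its universal property is
`copowerHomEquiv`. -/
def copower (V : Type u) [AddCommGroup V] [Module k V] [Module.Finite k V] (X : HopfBimod δ) :
    HopfBimod δ where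
  carrier := V ⊗[k] X
  str := {
    coact := (TensorProduct.leftComm k V H X).toLinearMap ∘ₗ X.str.coact.lTensor V
    lact := LinearMap.lTensorHom V ∘ₗ X.str.lact
    ract := (LinearMap.lTensorHom V ∘ₗ X.str.ract.flip).flip
    isLeftCoaction := by
      have key (v : V) (t : H ⊗[k] X) :
          ((TensorProduct.leftComm k V H X).toLinearMap ∘ₗ X.str.coact.lTensor V).lTensor H
            ((TensorProduct.mk k V X v).lTensor H t) =
          ((TensorProduct.mk k V X v).lTensor H).lTensor H (X.str.coact.lTensor H t) := by
        induction t with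
        | zero => simp
        | add s t hs ht => simp only [map_add, hs, ht]
        | tmul h x => simp [leftComm_tmul]
      have key2 (v : V) (t : H ⊗[k] X) :
          TensorProduct.assoc k H H (V ⊗[k] X) ((Coalgebra.comul (R := k) (A := H)).rTensor _
            ((TensorProduct.mk k V X v).lTensor H t)) =
          ((TensorProduct.mk k V X v).lTensor H).lTensor H (TensorProduct.assoc k H H X
            ((Coalgebra.comul (R := k) (A := H)).rTensor _ t)) := by
        induction t with
        | zero => simp
        | add s t hs ht => simp only [map_add, hs, ht]
        | tmul h x =>
          simp only [LinearMap.lTensor_tmul, LinearMap.rTensor_tmul]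
          induction (Coalgebra.comul (R := k) h) with
          | zero => simp
          | add s t hs ht => simp only [add_tmul, map_add, hs, ht]
          | tmul h x => simp
      have key3 (v : V) (t : H ⊗[k] X) :
          (Coalgebra.counit (R := k) (A := H)).rTensor (V ⊗[k] X)
            ((TensorProduct.mk k V X v).lTensor H t) =
          (TensorProduct.mk k V X v).lTensor k
            ((Coalgebra.counit (R := k) (A := H)).rTensor X t) := by
        induction t with
        | zero => simp
        | add s t hs ht => simp only [map_add, hs, ht]
        | tmul h x => simp
      constructor
      · intro m
        induction m with
        | zero => simp
        | add s t hs ht => simp only [map_add, hs, ht]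
        | tmul v x =>
          simp only [LinearMap.comp_apply, LinearMap.lTensor_tmul, LinearEquiv.coe_coe,
            leftComm_tmul]
          rw [key2, ← X.str.isLeftCoaction.coassoc, ← key]
      · intro m
        induction m with
        | zero => simp
        | add s t hs ht => simp only [map_add, hs, ht, tmul_add]
        | tmul v x =>
          simp only [LinearMap.comp_apply, LinearMap.lTensor_tmul, LinearEquiv.coe_coe,
            leftComm_tmul]
          rw [key3, X.str.isLeftCoaction.counit]
          simp
    one_lact := by
      intro m
      induction m with
      | zero => simp
      | add s t hs ht => simp only [map_add, hs, ht]
      | tmul v x => simp [X.str.one_lact]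
    mul_lact := by
      intro a b m
      induction m with
      | zero => simp
      | add s t hs ht => simp only [map_add, hs, ht]
      | tmul v x => simp [X.str.mul_lact]
    ract_one := by
      intro m
      induction m with
      | zero => simp
      | add s t hs ht => simp only [map_add, LinearMap.add_apply, hs, ht]
      | tmul v x => simp [X.str.ract_one]
    ract_mul := by
      intro m a b
      induction m with
      | zero => simp
      | add s t hs ht => simp only [map_add, LinearMap.add_apply, hs, ht]
      | tmul v x => simp [X.str.ract_mul]
    lact_ract := by
      intro a m b
      induction m with
      | zero => simp
      | add s t hs ht => simp only [map_add, LinearMap.add_apply, hs, ht]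
      | tmul v x => simp [X.str.lact_ract]
    coact_lact := by
      intro a m
      induction m with
      | zero => simp
      | add s t hs ht => simp only [map_add, hs, ht]
      | tmul v x =>
        simp only [LinearMap.comp_apply, LinearMap.lTensor_tmul, LinearEquiv.coe_coe,
          LinearMap.coe_lTensorHom, leftComm_tmul, X.str.coact_lact]
        exact map₂_lTensor _ _ _ (fun _ _ => rfl) _ _
    coact_ract := by
      intro m b
      induction m with
      | zero => simp
      | add s t hs ht => simp only [map_add, LinearMap.add_apply, hs, ht]
      | tmul v x =>
        simp only [LinearMap.comp_apply, LinearMap.lTensor_tmul, LinearEquiv.coe_coe,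
          LinearMap.coe_lTensorHom, LinearMap.flip_apply, leftComm_tmul, X.str.coact_ract]
        exact map₂_lTensor' _ _ _ (fun _ _ => rfl) _ _ }

section

variable {V W : Type u} [AddCommGroup V] [Module k V] [Module.Finite k V]
  [AddCommGroup W] [Module k W] [Module.Finite k W]

@[simp] theorem copower_lact (X : HopfBimod δ) (a : A) (v : V) (x : X) :
    (copower V X).str.lact a (v ⊗ₜ[k] x) = v ⊗ₜ[k] X.str.lact a x := rfl

@[simp] theorem copower_ract (X : HopfBimod δ) (a : A) (v : V) (x : X) :
    (copower V X).str.ract (v ⊗ₜ[k] x) a = v ⊗ₜ[k] X.str.ract x a := rfl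

@[simp] theorem copower_coact (X : HopfBimod δ) (v : V) (x : X) :
    (copower V X).str.coact (v ⊗ₜ[k] x) =
      (TensorProduct.mk k V X v).lTensor H (X.str.coact x) :=
  leftComm_tmul H v _

/-- A linear map out of a copower whose restriction to each `v ⊗ X` is a morphism is a
morphism. -/
theorem mem_homs_copower {X Y : HopfBimod δ} (F : V ⊗[k] X →ₗ[k] Y)
    (hF : ∀ v : V, F ∘ₗ TensorProduct.mk k V X v ∈ homs X Y) : F ∈ homs (copower V X) Y := by
  have h1 (a : A) : F ∘ₗ (X.str.lact a).lTensor V = Y.str.lact a ∘ₗ F :=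
    TensorProduct.ext' fun v x => (hF v).1 a x
  have h2 (a : A) : F ∘ₗ (X.str.ract.flip a).lTensor V = Y.str.ract.flip a ∘ₗ F :=
    TensorProduct.ext' fun v x => (hF v).2.1 x a
  have h3 : Y.str.coact ∘ₗ F =
      F.lTensor H ∘ₗ (TensorProduct.leftComm k V H X).toLinearMap ∘ₗ X.str.coact.lTensor V :=
    TensorProduct.ext' fun v x => by
      refine ((hF v).2.2 x).trans ?_
      rw [LinearMap.lTensor_comp]
      exact congrArg (F.lTensor H) (leftComm_tmul H v _).symm
  exact ⟨fun a m => LinearMap.congr_fun (h1 a) m, fun m a => LinearMap.congr_fun (h2 a) m,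
    fun m => LinearMap.congr_fun h3 m⟩

theorem mk_mem_homs (X : HopfBimod δ) (v : V) :
    (TensorProduct.mk k V X v : X →ₗ[k] copower V X) ∈ homs X (copower V X) :=
  ⟨fun _ _ => rfl, fun _ _ => rfl, fun x => copower_coact X v x⟩

/-- The structure morphism `X → V ⊙ X` belonging to `v`. -/
def copowerMk (X : HopfBimod δ) (v : V) : X ⟶ copower V X := ⟨_, mk_mem_homs X v⟩

@[simp] theorem toLin_copowerMk (X : HopfBimod δ) (v : V) :
    toLin (copowerMk X v) = TensorProduct.mk k V X v := rfl

/-- Functoriality of the copower in both variables. -/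
def copowerMap (φ : V →ₗ[k] W) {X Y : HopfBimod δ} (f : X ⟶ Y) : copower V X ⟶ copower W Y :=
  ⟨TensorProduct.map φ (toLin f), mem_homs_copower _ fun v =>
    (f ≫ copowerMk Y (φ v)).2⟩

@[simp] theorem toLin_copowerMap (φ : V →ₗ[k] W) {X Y : HopfBimod δ} (f : X ⟶ Y) :
    toLin (copowerMap φ f) = TensorProduct.map φ (toLin f) := rfl

/-- The universal property of the copower: `Hom(V ⊙ X, Y) ≅ Hom_k(V, Hom(X, Y))`. -/
def copowerHomEquiv (V : Type u) [AddCommGroup V] [Module k V] [Module.Finite k V]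
    (X Y : HopfBimod δ) : (copower V X ⟶ Y) ≃ₗ[k] (V →ₗ[k] (X ⟶ Y)) where
  toFun F := {
    toFun := fun v => copowerMk X v ≫ F
    map_add' := fun v w => by
      ext1
      exact LinearMap.ext fun x =>
        (congrArg (toLin F) (TensorProduct.add_tmul v w x)).trans (map_add (toLin F) _ _)
    map_smul' := fun c v => by
      ext1
      exact LinearMap.ext fun x =>
        (congrArg (toLin F) (TensorProduct.smul_tmul' c v x).symm).trans
          (map_smul (toLin F) c _) }
  map_add' F G := by ext1 v; ext1; rfl
  map_smul' c F := by ext1 v; ext1; rfl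
  invFun φ := ⟨TensorProduct.lift ((homs X Y).subtype ∘ₗ φ), mem_homs_copower _ fun v => (φ v).2⟩
  left_inv F := by
    ext1
    exact TensorProduct.ext' fun v x => rfl
  right_inv φ := by
    ext1 v
    exact Subtype.ext (LinearMap.ext fun x => rfl)

end

/-- The bifunctor `(X, Y) ↦ Hom(M, X)^* ⊙ Y`, contravariant in `X` and covariant in `Y`. -/
def nakayamaDiagram (M : HopfBimod δ) : (HopfBimod δ)ᵒᵖ ⥤ HopfBimod δ ⥤ HopfBimod δ where
  obj X := {
    obj := fun Y => copower (Module.Dual k (M ⟶ X.unop)) Y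
    map := fun g => copowerMap LinearMap.id g
    map_id := fun Y => by
      ext1
      exact TensorProduct.map_id
    map_comp := fun f g => by
      ext1
      exact TensorProduct.ext' fun v x => rfl }
  map f := {
    app := fun Y => copowerMap (postcomp M f.unop).dualMap (𝟙 Y)
    naturality := fun Y Z g => by
      ext1
      exact TensorProduct.ext' fun v x => rfl }
  map_id X := by
    apply NatTrans.ext
    funext Y
    apply hom_ext
    have h : (postcomp M (𝟙 X.unop)).dualMap = LinearMap.id := by
      ext v f
      simp [postcomp]
    exact TensorProduct.ext' fun v x => congrArg (· ⊗ₜ[k] x) (LinearMap.congr_fun h v)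
  map_comp {X Y Z} f g := by
    apply NatTrans.ext
    funext W
    apply hom_ext
    have h : (postcomp M (f ≫ g).unop).dualMap =
        (postcomp M g.unop).dualMap ∘ₗ (postcomp M f.unop).dualMap := by
      ext v h
      simp [postcomp]
    exact TensorProduct.ext' fun v x => congrArg (· ⊗ₜ[k] x) (LinearMap.congr_fun h v)

/-- `N` is the value at `M` of the Nakayama functor, the coend of `Hom(M, X)^* ⊙ X` over all
objects `X`. -/
def IsNakayama (M N : HopfBimod δ) : Prop :=
  ∃ _ : Limits.HasCoend (nakayamaDiagram M), Nonempty (N ≅ Limits.coend (nakayamaDiagram M))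

end HopfBimod

theorem mul_eq_map₂ {k H A : Type u} [Field k] [Ring H] [HopfAlgebra k H] [Ring A] [Algebra k A]
    (s t : H ⊗[k] A) :
    s * t = TensorProduct.map₂ (LinearMap.mul k H) (LinearMap.mul k A) s t := by
  induction s with
  | zero => simp
  | add s s' hs hs' => simp only [add_mul, map_add, LinearMap.add_apply, hs, hs']
  | tmul p b =>
    induction t with
    | zero => simp
    | add t t' ht ht' => simp only [mul_add, map_add, ht, ht']
    | tmul q x => simp

section Main

variable {k H A : Type u} [Field k] [Ring H] [HopfAlgebra k H] [Ring A] [Algebra k A]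
  [FiniteDimensional k A]

/-- The unit object of the monoidal category `_A C_A` (with product the tensor product over `A`):
`A` with its multiplication and its own coaction. -/
def unitObj (δ : LeftComoduleAlgebra k H A) : HopfBimod δ where
  carrier := A
  str := {
    coact := δ.coact.toLinearMap
    lact := LinearMap.mul k A
    ract := LinearMap.mul k A
    isLeftCoaction := δ.isLeftCoaction
    one_lact := by simp
    mul_lact := by simp [mul_assoc]
    ract_one := by simp
    ract_mul := by simp [mul_assoc]
    lact_ract := by simp [mul_assoc]
    coact_lact := fun a m => (map_mul δ.coact a m).trans (mul_eq_map₂ _ _)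
    coact_ract := fun a m => (map_mul δ.coact a m).trans (mul_eq_map₂ _ _) }

/-- `N` is the modular object of `_A C_A`: the value of the Nakayama functor at the unit object. -/
def IsModularObject (δ : LeftComoduleAlgebra k H A) (N : HopfBimod δ) : Prop :=
  HopfBimod.IsNakayama (unitObj δ) N

end Main

end

/-! The category has a strong generator: P = A ⊗ H ⊗ A with p = 1 ⊗ Λ ⊗ 1. Since f ↦ Λ ↼ f is a
bijection H^* → H, every element x of every X is q(p) for some morphism q : P → X
(`exists_hom_generator`). A cowedge under Hom(M, X)^* ⊙ X is a natural family Hom(M, X)^* → Hom(X,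
Z), so it is determined by its component at P evaluated at p. A family π with values in N is
universal as soon as ξ ↦ π_P(ξ)(p) is a bijection Hom(M, P)^* → N (`IsNaturalFamily.isNakayama`).

For M = A, a morphism A → X is the same as a central coinvariant element of X, and such elements
arise by averaging: τ(x) = ∑ λ_H(g_A x₍₋₁₎) eᵢ x₍₀₎ eⁱ, where ∑ eᵢ ⊗ eⁱ is the Casimir element of
λ_A. The universal family is defined by λ_A(π(ξ)(x) b) = ξ(τ(x b)), which is right A-linear by
construction. Two identities for τ dictate the rest of the structure on A. - τ(x ν(a)) = τ((a ↼ α)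
x) (`average_ract_nakayama`) gives the left action; one ν comes from here, the other from moving a
factor around inside λ_A. - x₍₋₁₎ ⊗ τ(x₍₀₎) = g_A⁻¹ g_H ⊗ τ(x) (`lTensor_average`) gives the
coaction; the second g_A⁻¹ compensates the g_A produced by λ_A, and g_A commutes with g_H.

Bijectivity at P reduces to b ↦ τ(p b) being a bijection A → Hom(A, P): the form λ_A ⊗ ε ⊗ id is
injective on central coinvariants (`generatorTrace_eq_zero`) and sends τ(p b) to λ_H(Λ)(b ↼ α)
(`generatorTrace_average`). The axioms of a relative Hopf bimodule on the twisted A are inherited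
from P, because the maps π_P(ξ) reach every element of A.

The facts needed about H (non-degeneracy of λ_H, λ_H(Λ) ≠ 0, injectivity of S, existence of g_H and
α_H, the Nakayama automorphism of λ_H) are derived from λ(h₍₁₎ z) h₍₂₎ = λ(h z₍₁₎) S(z₍₂₎) and its
special case `coactConv_integral`. -/

noncomputable section

/-! ### Convolution, and cancellation of the antipode. -/

section Convolution

variable {k H M B : Type u} [Field k] [Ring H] [HopfAlgebra k H] [AddCommGroup M] [Module k M]
  [Ring B] [Algebra k B]

/-- The action of `f : H → B` on `φ : M → B` for a left `H`-comodule `M`: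
`m ↦ f(m₍₋₁₎) φ(m₍₀₎)`. For `M = H` this is the convolution product. -/
def coactConv (δ : M →ₗ[k] H ⊗[k] M) (f : H →ₗ[k] B) (φ : M →ₗ[k] B) : M →ₗ[k] B :=
  LinearMap.mul' k B ∘ₗ TensorProduct.map f φ ∘ₗ δ

theorem coactConv_apply (δ : M →ₗ[k] H ⊗[k] M) (f : H →ₗ[k] B) (φ : M →ₗ[k] B) (m : M) :
    coactConv δ f φ m = LinearMap.mul' k B (TensorProduct.map f φ (δ m)) := rfl

theorem isLeftCoaction_comul :
    IsLeftCoaction (k := k) (H := H) (Coalgebra.comul (R := k) (A := H)) :=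
  ⟨fun m => (Coalgebra.coassoc_apply m).symm, fun m => Coalgebra.rTensor_counit_comul m⟩

/-- With `counit_coactConv`, this makes Hom(M, B) a left module over the convolution algebra Hom(H,
B). Later antipode manipulations are then multiplication by the convolution inverse j ∘ S of an
algebra map j. -/
theorem coactConv_coactConv {δ : M →ₗ[k] H ⊗[k] M} (hδ : IsLeftCoaction δ) (f f' : H →ₗ[k] B)
    (φ : M →ₗ[k] B) :
    coactConv δ f (coactConv δ f' φ) =
      coactConv δ (coactConv (Coalgebra.comul (R := k)) f f') φ := by
  ext m
  have h1 (s : H ⊗[k] M) : LinearMap.mul' k B (TensorProduct.map f (coactConv δ f' φ) s) =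
      LinearMap.mul' k B (TensorProduct.map f (LinearMap.mul' k B ∘ₗ TensorProduct.map f' φ)
        (δ.lTensor H s)) := by
    induction s with
    | zero => simp
    | add s t hs ht => simp only [map_add, hs, ht]
    | tmul h x => simp [coactConv_apply]
  have h3 (t : H ⊗[k] H) (x : M) :
      LinearMap.mul' k B (TensorProduct.map f (LinearMap.mul' k B ∘ₗ TensorProduct.map f' φ)
        (TensorProduct.assoc k H H M (t ⊗ₜ x))) =
      LinearMap.mul' k B (TensorProduct.map f f' t) * φ x := by
    induction t with
    | zero => simp
    | add s t hs ht => simp only [map_add, hs, ht, add_tmul, add_mul]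
    | tmul h x => simp [mul_assoc]
  have h2 (s : H ⊗[k] M) :
      LinearMap.mul' k B (TensorProduct.map f (LinearMap.mul' k B ∘ₗ TensorProduct.map f' φ)
        (TensorProduct.assoc k H H M ((Coalgebra.comul (R := k) (A := H)).rTensor M s))) =
      LinearMap.mul' k B (TensorProduct.map (coactConv (Coalgebra.comul (R := k)) f f') φ s) := by
    induction s with
    | zero => simp
    | add s t hs ht => simp only [map_add, hs, ht]
    | tmul h x => simp [h3, coactConv_apply]
  rw [coactConv_apply, h1, hδ.coassoc, h2, coactConv_apply]

theorem counit_coactConv {δ : M →ₗ[k] H ⊗[k] M} (hδ : IsLeftCoaction δ) (φ : M →ₗ[k] B) :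
    coactConv δ (Algebra.linearMap k B ∘ₗ Coalgebra.counit) φ = φ := by
  ext m
  have h (s : H ⊗[k] M) : LinearMap.mul' k B
      (TensorProduct.map (Algebra.linearMap k B ∘ₗ Coalgebra.counit) φ s) =
      φ (TensorProduct.lid k M ((Coalgebra.counit (R := k) (A := H)).rTensor M s)) := by
    induction s with
    | zero => simp
    | add s t hs ht => simp only [map_add, hs, ht]
    | tmul h x => simp [Algebra.smul_def]
  rw [coactConv_apply, h, hδ.counit]
  simp

theorem coactConv_counit (f : H →ₗ[k] B) :
    coactConv (Coalgebra.comul (R := k)) f (Algebra.linearMap k B ∘ₗ Coalgebra.counit) = f := by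
  ext m
  have h (s : H ⊗[k] H) : LinearMap.mul' k B
      (TensorProduct.map f (Algebra.linearMap k B ∘ₗ Coalgebra.counit) s) =
      f (TensorProduct.rid k H ((Coalgebra.counit (R := k) (A := H)).lTensor H s)) := by
    induction s with
    | zero => simp
    | add s t hs ht => simp only [map_add, hs, ht]
    | tmul h x => simp [← Algebra.commutes, ← Algebra.smul_def]
  rw [coactConv_apply, h]
  simp

theorem algHom_comp_coactConv {B' : Type u} [Ring B'] [Algebra k B'] (δ : M →ₗ[k] H ⊗[k] M)
    (f : H →ₗ[k] B) (φ : M →ₗ[k] B) (j : B →ₐ[k] B') :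
    coactConv δ (j.toLinearMap ∘ₗ f) (j.toLinearMap ∘ₗ φ) = j.toLinearMap ∘ₗ coactConv δ f φ := by
  ext m
  simp only [LinearMap.comp_apply, coactConv_apply]
  induction δ m with
  | zero => simp
  | add s t hs ht => simp only [map_add, hs, ht]
  | tmul h x => simp

theorem coactConv_antipode (j : H →ₐ[k] B) :
    coactConv (Coalgebra.comul (R := k)) j.toLinearMap (j.toLinearMap ∘ₗ HopfAlgebra.antipode k) =
      Algebra.linearMap k B ∘ₗ Coalgebra.counit := by
  have h := algHom_comp_coactConv (Coalgebra.comul (R := k) (A := H)) LinearMap.id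
    (HopfAlgebra.antipode k) j
  rw [LinearMap.comp_id] at h
  rw [h]
  ext m
  have := HopfAlgebra.mul_antipode_lTensor_comul_apply (R := k) m
  simp only [LinearMap.comp_apply, coactConv_apply]
  rw [← LinearMap.lTensor_def, this]
  simp

theorem antipode_coactConv (j : H →ₐ[k] B) :
    coactConv (Coalgebra.comul (R := k)) (j.toLinearMap ∘ₗ HopfAlgebra.antipode k) j.toLinearMap =
      Algebra.linearMap k B ∘ₗ Coalgebra.counit := by
  have h := algHom_comp_coactConv (Coalgebra.comul (R := k) (A := H))
    (HopfAlgebra.antipode k) LinearMap.id j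
  rw [LinearMap.comp_id] at h
  rw [h]
  ext m
  have := HopfAlgebra.mul_antipode_rTensor_comul_apply (R := k) m
  simp only [LinearMap.comp_apply, coactConv_apply]
  rw [← LinearMap.rTensor_def, this]
  simp

/-- If `j(m₍₋₁₎) φ(m₍₀₎) = ψ(m)`, then `φ(m) = j(S(m₍₋₁₎)) ψ(m₍₀₎)`. -/
theorem eq_antipode_coactConv {δ : M →ₗ[k] H ⊗[k] M} (hδ : IsLeftCoaction δ) (j : H →ₐ[k] B)
    {φ ψ : M →ₗ[k] B} (h : coactConv δ j.toLinearMap φ = ψ) :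
    φ = coactConv δ (j.toLinearMap ∘ₗ HopfAlgebra.antipode k) ψ := by
  rw [← h, coactConv_coactConv hδ, antipode_coactConv, counit_coactConv hδ]

theorem eq_zero_of_antipode_coactConv {δ : M →ₗ[k] H ⊗[k] M} (hδ : IsLeftCoaction δ)
    (j : H →ₐ[k] B) {φ : M →ₗ[k] B}
    (h : coactConv δ (j.toLinearMap ∘ₗ HopfAlgebra.antipode k) φ = 0) : φ = 0 := by
  rw [← counit_coactConv hδ φ, ← coactConv_antipode j, ← coactConv_coactConv hδ, h]
  ext m
  simp [coactConv]

/-- If `G(h₍₁₎) j(h₍₂₎) = K(h)`, then `G(h) = K(h₍₁₎) j(S(h₍₂₎))`. -/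
theorem eq_coactConv_antipode (j : H →ₐ[k] B) {G K : H →ₗ[k] B}
    (h : coactConv (Coalgebra.comul (R := k)) G j.toLinearMap = K) :
    G = coactConv (Coalgebra.comul (R := k)) K (j.toLinearMap ∘ₗ HopfAlgebra.antipode k) := by
  rw [← h, ← coactConv_coactConv isLeftCoaction_comul, coactConv_antipode, coactConv_counit]

end Convolution

/-- Linear forms on `V` separate the elements of `V ⊗ M`. -/
theorem ext_of_rTensor {k V M : Type u} [Field k] [AddCommGroup V] [Module k V] [AddCommGroup M]
    [Module k M] {s t : V ⊗[k] M}
    (h : ∀ f : V →ₗ[k] k, TensorProduct.lid k M (f.rTensor M s) =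
      TensorProduct.lid k M (f.rTensor M t)) : s = t := by
  let b := Module.Free.chooseBasis k V
  apply (TensorProduct.equivFinsuppOfBasisLeft (N := M) b).injective
  ext i
  rw [TensorProduct.equivFinsuppOfBasisLeft_apply, TensorProduct.equivFinsuppOfBasisLeft_apply]
  exact h (b.coord i)

/-! ### The actions of linear forms on comodules. -/

section HitRight

variable {k H M : Type u} [Field k] [Ring H] [HopfAlgebra k H] [AddCommGroup M] [Module k M]

theorem hitRight_apply (δ : M →ₗ[k] H ⊗[k] M) (f : H →ₗ[k] k) (m : M) :
    hitRight δ f m = TensorProduct.lid k M (f.rTensor M (δ m)) := rfl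

theorem hitRight_counit {δ : M →ₗ[k] H ⊗[k] M} (hδ : IsLeftCoaction δ) (m : M) :
    hitRight δ Coalgebra.counit m = m := by
  rw [hitRight_apply, hδ.counit]
  simp

/-- The linear map `h ↦ h₍₁₎ f(h₍₂₎)`. -/
def hitLeft (f : H →ₗ[k] k) : H →ₗ[k] H :=
  (TensorProduct.rid k H).toLinearMap ∘ₗ f.lTensor H ∘ₗ Coalgebra.comul

theorem hitLeft_apply (f : H →ₗ[k] k) (h : H) :
    hitLeft f h = TensorProduct.rid k H (f.lTensor H (Coalgebra.comul (R := k) h)) := rfl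

/-- By coassociativity `f` acts on the outermost leg here, and on the middle leg in
`lTensor_hitRight`. When `f` is a twisted cointegral both expressions collapse to a fixed grouplike
tensored with m ↼ f. -/
theorem coact_hitRight {δ : M →ₗ[k] H ⊗[k] M} (hδ : IsLeftCoaction δ) (f : H →ₗ[k] k) (m : M) :
    δ (hitRight δ f m) = (hitRight (Coalgebra.comul (R := k)) f).rTensor M (δ m) := by
  have h1 (s : H ⊗[k] M) : δ (TensorProduct.lid k M (f.rTensor M s)) =
      TensorProduct.lid k (H ⊗[k] M) (f.rTensor (H ⊗[k] M) (δ.lTensor H s)) := by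
    induction s with
    | zero => simp
    | add s t hs ht => simp only [map_add, hs, ht]
    | tmul h x => simp
  have h3 (t : H ⊗[k] H) (x : M) :
      TensorProduct.lid k (H ⊗[k] M) (f.rTensor (H ⊗[k] M)
        (TensorProduct.assoc k H H M (t ⊗ₜ x))) =
      TensorProduct.lid k H (f.rTensor H t) ⊗ₜ x := by
    induction t with
    | zero => simp
    | add s t hs ht => simp only [map_add, hs, ht, add_tmul]
    | tmul h x => simp [smul_tmul']
  have h2 (s : H ⊗[k] M) : TensorProduct.lid k (H ⊗[k] M) (f.rTensor (H ⊗[k] M)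
        (TensorProduct.assoc k H H M ((Coalgebra.comul (R := k) (A := H)).rTensor M s))) =
      (hitRight (Coalgebra.comul (R := k)) f).rTensor M s := by
    induction s with
    | zero => simp
    | add s t hs ht => simp only [map_add, hs, ht]
    | tmul h x => simp [h3, hitRight_apply]
  rw [hitRight_apply, h1, hδ.coassoc, h2]

theorem lTensor_hitRight {δ : M →ₗ[k] H ⊗[k] M} (hδ : IsLeftCoaction δ) (f : H →ₗ[k] k) (m : M) :
    (hitRight δ f).lTensor H (δ m) = (hitLeft f).rTensor M (δ m) := by
  have h1 (s : H ⊗[k] M) : (hitRight δ f).lTensor H s =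
      ((TensorProduct.lid k M).toLinearMap ∘ₗ f.rTensor M).lTensor H (δ.lTensor H s) := by
    induction s with
    | zero => simp
    | add s t hs ht => simp only [map_add, hs, ht]
    | tmul h x => simp [hitRight_apply]
  have h3 (t : H ⊗[k] H) (x : M) :
      ((TensorProduct.lid k M).toLinearMap ∘ₗ f.rTensor M).lTensor H
        (TensorProduct.assoc k H H M (t ⊗ₜ x)) =
      TensorProduct.rid k H (f.lTensor H t) ⊗ₜ x := by
    induction t with
    | zero => simp
    | add s t hs ht => simp only [map_add, hs, ht, add_tmul]
    | tmul h x => simp [smul_tmul']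
  have h2 (s : H ⊗[k] M) : ((TensorProduct.lid k M).toLinearMap ∘ₗ f.rTensor M).lTensor H
        (TensorProduct.assoc k H H M ((Coalgebra.comul (R := k) (A := H)).rTensor M s)) =
      (hitLeft f).rTensor M s := by
    induction s with
    | zero => simp
    | add s t hs ht => simp only [map_add, hs, ht]
    | tmul h x => simp [h3, hitLeft_apply]
  rw [h1, hδ.coassoc, h2]

theorem hitRight_hitRight {δ : M →ₗ[k] H ⊗[k] M} (hδ : IsLeftCoaction δ) (f f' : H →ₗ[k] k)
    (m : M) : hitRight δ f (hitRight δ f' m) =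
      hitRight δ (f ∘ₗ hitRight (Coalgebra.comul (R := k)) f') m := by
  rw [hitRight_apply, coact_hitRight hδ, hitRight_apply, LinearMap.rTensor_comp]
  rfl

theorem hitRight_add (δ : M →ₗ[k] H ⊗[k] M) (f f' : H →ₗ[k] k) (m : M) :
    hitRight δ (f + f') m = hitRight δ f m + hitRight δ f' m := by
  simp [hitRight_apply, LinearMap.rTensor_add]

theorem hitRight_smul (δ : M →ₗ[k] H ⊗[k] M) (c : k) (f : H →ₗ[k] k) (m : M) :
    hitRight δ (c • f) m = c • hitRight δ f m := by
  simp [hitRight_apply, LinearMap.rTensor_smul]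

end HitRight

end

noncomputable section

/-! ### Integrals and cointegrals of the Hopf algebra. -/

section Cointegral

variable {k H : Type u} [Field k] [Ring H] [HopfAlgebra k H]

local notation "Δ" => Coalgebra.comul (R := k) (A := H)
local notation "ε" => Coalgebra.counit (R := k) (A := H)
local notation "𝑺" => HopfAlgebra.antipode k (A := H)

/-- `λ(h₍₁₎ z) h₍₂₎ = λ(h z₍₁₎) S(z₍₂₎)` for a right cointegral `λ`. -/
theorem IsRightCointegral.lid_comul_mul {lam : H →ₗ[k] k} (hlam : IsRightCointegral lam)
    (h z : H) :
    TensorProduct.lid k H (lam.rTensor H (Δ h * (z ⊗ₜ 1))) =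
      coactConv Δ (Algebra.linearMap k H ∘ₗ lam ∘ₗ LinearMap.mulLeft k h) 𝑺 z := by
  let G : H →ₗ[k] H := (TensorProduct.lid k H).toLinearMap ∘ₗ lam.rTensor H ∘ₗ
    LinearMap.mulLeft k (Δ h) ∘ₗ
    (Algebra.TensorProduct.includeLeft (R := k) (S := k) (A := H) (B := H)).toLinearMap
  have key (t : H ⊗[k] H) : LinearMap.mul' k H (TensorProduct.map G LinearMap.id t) =
      TensorProduct.lid k H (lam.rTensor H (Δ h * t)) := by
    induction t with
    | zero => simp
    | add s t hs ht => simp only [map_add, mul_add, hs, ht]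
    | tmul a b =>
      simp only [TensorProduct.map_tmul, LinearMap.mul'_apply, LinearMap.id_apply, G,
        LinearMap.comp_apply, LinearMap.mulLeft_apply, LinearEquiv.coe_coe,
        AlgHom.toLinearMap_apply, Algebra.TensorProduct.includeLeft_apply]
      induction Δ h with
      | zero => simp
      | add s t hs ht => simp only [map_add, add_mul, hs, ht]
      | tmul c d => simp
  -- With G(z) = λ(h₍₁₎ z) h₍₂₎, the cointegral property at the product h w reads G(w₍₁₎) w₍₂₎ = λ(h
  -- w) 1; convolving with S isolates G.
  have hG : coactConv Δ G (AlgHom.id k H).toLinearMap =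
      Algebra.linearMap k H ∘ₗ lam ∘ₗ LinearMap.mulLeft k h := by
    ext w
    refine (key _).trans ?_
    rw [← Bialgebra.comul_mul, hlam]
    simp [Algebra.smul_def]
  exact LinearMap.congr_fun (eq_coactConv_antipode (AlgHom.id k H) hG) z

/-- The radical R = {h : λ(h -) = 0} satisfies Δ(R) ⊆ R ⊗ H, because λ(h₍₁₎ z) h₍₂₎ = λ(h z₍₁₎)
S(z₍₂₎) vanishes for h in R. -/
theorem hitLeft_mem_radical {lam : H →ₗ[k] k} (hlam : IsRightCointegral lam) {h : H}
    (h0 : ∀ z, lam (h * z) = 0) (φ : H →ₗ[k] k) (z : H) : lam (hitLeft φ h * z) = 0 := by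
  have h1 := hlam.lid_comul_mul h z
  have h2 : Algebra.linearMap k H ∘ₗ lam ∘ₗ LinearMap.mulLeft k h = 0 := by
    ext w
    simp [h0]
  rw [h2] at h1
  have h3 : lam (hitLeft φ h * z) =
      φ (TensorProduct.lid k H (lam.rTensor H (Δ h * (z ⊗ₜ 1)))) := by
    rw [hitLeft_apply]
    induction Δ h with
    | zero => simp
    | add s t hs ht => simp only [map_add, add_mul, hs, ht]
    | tmul c d => simp [mul_comm]
  rw [h3, h1]
  simp [coactConv]

/-- A non-zero right cointegral has no radical. -/
theorem IsRightCointegral.eq_zero {lam : H →ₗ[k] k} (hlam : IsRightCointegral lam)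
    (hlam0 : lam ≠ 0) {h : H} (h0 : ∀ z, lam (h * z) = 0) : h = 0 := by
  -- For h in the radical, ε(h) λ(z) = λ(h₍₁₎ S(h₍₂₎) z) = 0, since the first leg of Δ(h) stays in
  -- the radical.
  have h1 (h : H) (h0 : ∀ z, lam (h * z) = 0) : ε h = 0 := by
    obtain ⟨z, hz⟩ : ∃ z, lam z ≠ 0 := by
      by_contra! hc
      exact hlam0 (LinearMap.ext hc)
    let b := Module.Free.chooseBasis k H
    have h2 (s : H ⊗[k] H) (hs : ∀ (φ : H →ₗ[k] k) (w : H),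
        lam (TensorProduct.rid k H (φ.lTensor H s) * w) = 0) :
        lam (LinearMap.mul' k H (𝑺.lTensor H s) * z) = 0 := by
      have h4 : s = ((TensorProduct.equivFinsuppOfBasisRight (M := H) b) s).sum
          fun i m => m ⊗ₜ b i := by
        rw [← TensorProduct.equivFinsuppOfBasisRight_symm_apply, LinearEquiv.symm_apply_apply]
      rw [h4, Finsupp.sum, map_sum, map_sum, Finset.sum_mul, map_sum]
      refine Finset.sum_eq_zero fun i _ => ?_
      have := hs (b.coord i) (𝑺 (b i) * z)
      rw [TensorProduct.equivFinsuppOfBasisRight_apply]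
      simpa [mul_assoc] using this
    have h3 := h2 (Δ h) fun φ w => hitLeft_mem_radical hlam h0 φ w
    rw [HopfAlgebra.mul_antipode_lTensor_comul_apply, ← Algebra.smul_def, map_smul,
      smul_eq_mul] at h3
    exact (mul_eq_zero.1 h3).resolve_right hz
  -- φ(h) = ε(h₍₁₎ φ(h₍₂₎)), and the argument of ε lies in the radical again.
  refine (Module.forall_dual_apply_eq_zero_iff k h).1 fun φ => ?_
  have h2 := h1 _ (hitLeft_mem_radical hlam h0 φ)
  have h3 : ε (hitLeft φ h) = φ h := by
    have h4 (s : H ⊗[k] H) : ε (TensorProduct.rid k H (φ.lTensor H s)) =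
        φ (TensorProduct.lid k H ((ε).rTensor H s)) := by
      induction s with
      | zero => simp
      | add s t hs ht => simp only [map_add, hs, ht]
      | tmul c d => simp [mul_comm]
    rw [hitLeft_apply, h4]
    simp
  rw [← h3, h2]

/-- `λ(u Λ₍₁₎) S(Λ₍₂₎) = λ(Λ) u`. -/
theorem coactConv_integral {lam : H →ₗ[k] k} (hlam : IsRightCointegral lam)
    {L : H} (hL : IsLeftIntegral (k := k) L) (u : H) :
    coactConv Δ (Algebra.linearMap k H ∘ₗ lam ∘ₗ LinearMap.mulLeft k u) 𝑺 L = lam L • u := by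
  rw [← hlam.lid_comul_mul]
  have h4 (s : H ⊗[k] H) : TensorProduct.lid k H (lam.rTensor H (s * (L ⊗ₜ 1))) =
      lam L • TensorProduct.lid k H ((ε).rTensor H s) := by
    induction s with
    | zero => simp
    | add s t hs ht => simp only [map_add, add_mul, hs, ht, smul_add]
    | tmul c d => simp [hL c, smul_smul, mul_comm]
  rw [h4]
  simp

theorem coactConv_linearMap_antipode (f : H →ₗ[k] k) (h : H) :
    coactConv Δ (Algebra.linearMap k H ∘ₗ f) 𝑺 h = 𝑺 (hitRight Δ f h) := by
  rw [coactConv_apply, hitRight_apply]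
  induction Δ h with
  | zero => simp
  | add s t hs ht => simp only [map_add, hs, ht]
  | tmul c d => simp [← Algebra.smul_def]

theorem counit_groupLike (x : GroupLike k H) : ε (x : H) = 1 := x.2.counit_eq_one

theorem val_mul_val_inv (x : GroupLike k H) : (x : H) * ((x⁻¹ : GroupLike k H) : H) = 1 := by
  rw [← GroupLike.val_mul, mul_inv_cancel, GroupLike.val_one]

theorem val_inv_mul_val (x : GroupLike k H) : ((x⁻¹ : GroupLike k H) : H) * (x : H) = 1 := by
  rw [← GroupLike.val_mul, inv_mul_cancel, GroupLike.val_one]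

/-- As the target is commutative, α ∘ S is again an algebra map. It is the convolution inverse of α,
and its own convolution inverse is α ∘ S²; inverses are unique. -/
theorem algHom_antipode_antipode (α : H →ₐ[k] k) (h : H) : α (𝑺 (𝑺 h)) = α h := by
  let β : H →ₐ[k] k := AlgHom.ofLinearMap (α.toLinearMap ∘ₗ 𝑺) (by simp)
    (fun a b => by simp [HopfAlgebra.antipode_mul_antidistrib, mul_comm])
  have h1 : coactConv Δ β.toLinearMap α.toLinearMap =
      Algebra.linearMap k k ∘ₗ ε := antipode_coactConv α
  have h2 := eq_antipode_coactConv (isLeftCoaction_comul (k := k) (H := H)) β h1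
  rw [coactConv_counit] at h2
  exact (LinearMap.congr_fun h2 h).symm

theorem hitRight_antipode_hitRight {M : Type u} [AddCommGroup M] [Module k M]
    {δ : M →ₗ[k] H ⊗[k] M} (hδ : IsLeftCoaction δ) (α : H →ₐ[k] k) (m : M) :
    hitRight δ α.toLinearMap (hitRight δ (α.toLinearMap ∘ₗ 𝑺) m) = m := by
  have h1 : α.toLinearMap ∘ₗ hitRight Δ (α.toLinearMap ∘ₗ 𝑺) = ε := by
    have h2 := antipode_coactConv α
    ext h
    refine Eq.trans ?_ (LinearMap.congr_fun h2 h)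
    rw [LinearMap.comp_apply, hitRight_apply, coactConv_apply]
    induction Δ h with
    | zero => simp
    | add s t hs ht => simp only [map_add, hs, ht]
    | tmul c d => simp
  rw [hitRight_hitRight hδ, h1, hitRight_counit hδ]

variable [FiniteDimensional k H]

theorem IsRightCointegral.exists_eq {lam : H →ₗ[k] k} (hlam : IsRightCointegral lam)
    (hlam0 : lam ≠ 0) (φ : H →ₗ[k] k) : ∃ u : H, ∀ z, φ z = lam (u * z) := by
  let F : H →ₗ[k] Module.Dual k H := (LinearMap.mul k H).compr₂ lam
  have hF : Function.Injective F := by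
    rw [← LinearMap.ker_eq_bot, LinearMap.ker_eq_bot']
    intro h hh
    exact hlam.eq_zero hlam0 fun z => LinearMap.congr_fun hh z
  obtain ⟨u, hu⟩ := ((LinearMap.injective_iff_surjective_of_finrank_eq_finrank
    (Subspace.dual_finrank_eq (K := k) (V := H)).symm).1 hF) φ
  exact ⟨u, fun z => (LinearMap.congr_fun hu z).symm⟩

theorem IsRightCointegral.eq_zero' {lam : H →ₗ[k] k} (hlam : IsRightCointegral lam)
    (hlam0 : lam ≠ 0) {z : H} (h0 : ∀ u, lam (u * z) = 0) : z = 0 := by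
  refine (Module.forall_dual_apply_eq_zero_iff k z).1 fun φ => ?_
  obtain ⟨u, hu⟩ := hlam.exists_eq hlam0 φ
  rw [hu, h0]

/-- λ(u Λ) = ε(u) λ(Λ), so λ(Λ) = 0 would put Λ in the right radical of a non-degenerate form. -/
theorem cointegral_integral_ne_zero {lam : H →ₗ[k] k} (hlam : IsRightCointegral lam)
    (hlam0 : lam ≠ 0) {L : H} (hL : IsLeftIntegral (k := k) L) (hL0 : L ≠ 0) : lam L ≠ 0 := by
  intro h
  refine hL0 (hlam.eq_zero' hlam0 fun u => ?_)
  rw [hL, map_smul, h, smul_zero]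

/-- Since λ(u Λ h) = ε(u) λ(Λ h), the elements Λ h and λ(Λ)⁻¹ λ(Λ h) Λ pair equally with every u.
Multiplicativity is read off from Λ ≠ 0. -/
theorem exists_leftModularFunction {lam : H →ₗ[k] k} (hlam : IsRightCointegral lam)
    (hlam0 : lam ≠ 0) {L : H} (hL : IsLeftIntegral (k := k) L) (hL0 : L ≠ 0) :
    ∃ α : H →ₐ[k] k, IsLeftModularFunction L α := by
  have hLL := cointegral_integral_ne_zero hlam hlam0 hL hL0
  let α : H →ₗ[k] k := (lam L)⁻¹ • lam ∘ₗ LinearMap.mulLeft k L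
  have hα (h : H) : L * h = α h • L := by
    rw [← sub_eq_zero]
    refine hlam.eq_zero' hlam0 fun u => ?_
    simp only [α, mul_sub, ← mul_assoc, map_sub, LinearMap.smul_apply, LinearMap.comp_apply,
      LinearMap.mulLeft_apply, mul_smul_comm, map_smul, hL u, smul_mul_assoc, smul_eq_mul]
    field_simp
    simp
  have hinj {c d : k} (h : c • L = d • L) : c = d := smul_left_injective k hL0 h
  refine ⟨AlgHom.ofLinearMap α (hinj ?_) (fun h h' => hinj ?_), hα⟩
  · rw [← hα]; simp
  · rw [← hα, ← mul_assoc, hα, smul_mul_assoc, hα, smul_smul]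

/-- `coactConv_integral` exhibits a preimage of λ(Λ) u under S, so S is surjective, hence injective
in finite dimension. -/
theorem antipode_injective {lam : H →ₗ[k] k} (hlam : IsRightCointegral lam)
    (hlam0 : lam ≠ 0) {L : H} (hL : IsLeftIntegral (k := k) L) (hL0 : L ≠ 0) :
    Function.Injective 𝑺 := by
  have hLL := cointegral_integral_ne_zero hlam hlam0 hL hL0
  rw [LinearMap.injective_iff_surjective]
  intro u
  have h := coactConv_integral hlam hL u
  rw [coactConv_linearMap_antipode] at h
  refine ⟨(lam L)⁻¹ • hitRight Δ (lam ∘ₗ LinearMap.mulLeft k u) L, ?_⟩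
  rw [map_smul, h, smul_smul, inv_mul_cancel₀ hLL, one_smul]

/-- Right cointegrals are unique up to scalars. -/
theorem IsRightCointegral.eq_smul {lam : H →ₗ[k] k} (hlam : IsRightCointegral lam)
    (hlam0 : lam ≠ 0) {L : H} (hL : IsLeftIntegral (k := k) L) {μ : H →ₗ[k] k}
    (hμ : IsRightCointegral μ) (h : H) : lam L * μ h = μ L * lam h := by
  -- Writing μ = λ(c -) and evaluating μ(Λ₍₁₎) S(Λ₍₂₎) in two ways gives μ(Λ) 1 = λ(Λ) c, so c is a
  -- scalar.
  obtain ⟨c, hc⟩ := hlam.exists_eq hlam0 μ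
  have h1 := coactConv_integral hlam hL c
  have h2 := coactConv_integral hμ hL 1
  have h3 : μ ∘ₗ LinearMap.mulLeft k 1 = lam ∘ₗ LinearMap.mulLeft k c := by
    ext z
    simp [hc]
  rw [h3, h1] at h2
  have h4 := congrArg (fun x => lam (x * h)) h2
  simpa [← hc] using h4

/-- For every φ the form h ↦ φ(h₍₁₎) λ(h₍₂₎) is again a right cointegral, hence a multiple of λ.
This forces h₍₁₎ λ(h₍₂₎) = λ(h) g with g = λ(Λ)⁻¹ Λ₍₁₎ λ(Λ₍₂₎), and coassociativity at Λ makes g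
grouplike. -/
theorem exists_distinguishedGrouplike {lam : H →ₗ[k] k} (hlam : IsRightCointegral lam)
    (hlam0 : lam ≠ 0) {L : H} (hL : IsLeftIntegral (k := k) L) (hL0 : L ≠ 0) :
    ∃ g : GroupLike k H, IsDistinguishedGrouplike lam g := by
  have hLL := cointegral_integral_ne_zero hlam hlam0 hL hL0
  have hcoint (φ : H →ₗ[k] k) : IsRightCointegral (φ ∘ₗ hitLeft lam) := by
    intro h
    have h1 : lam ∘ₗ hitRight Δ φ = φ ∘ₗ hitLeft lam := by
      ext h
      simp only [LinearMap.comp_apply, hitLeft_apply, hitRight_apply]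
      induction Δ h with
      | zero => simp
      | add s t hs ht => simp only [map_add, hs, ht]
      | tmul c d => simp [mul_comm]
    rw [← h1, LinearMap.rTensor_comp, LinearMap.comp_apply, ← coact_hitRight isLeftCoaction_comul,
      hlam]
    rfl
  have hg (h : H) : hitLeft lam h = lam h • ((lam L)⁻¹ • hitLeft lam L) := by
    rw [← sub_eq_zero]
    refine (Module.forall_dual_apply_eq_zero_iff k _).1 fun φ => ?_
    have := hlam.eq_smul hlam0 hL (hcoint φ) h
    simp only [LinearMap.comp_apply] at this
    simp only [map_sub, map_smul, smul_eq_mul, sub_eq_zero]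
    field_simp
    linear_combination this
  set g := (lam L)⁻¹ • hitLeft lam L
  have hε (h : H) : ε (hitLeft lam h) = lam h := by
    have h4 (s : H ⊗[k] H) : ε (TensorProduct.rid k H (lam.lTensor H s)) =
        lam (TensorProduct.lid k H ((ε).rTensor H s)) := by
      induction s with
      | zero => simp
      | add s t hs ht => simp only [map_add, hs, ht]
      | tmul c d => simp [mul_comm]
    rw [hitLeft_apply, h4]
    simp
  have hΔ (h : H) : Δ (hitLeft lam h) = (hitLeft lam).lTensor H (Δ h) := by
    refine ext_of_rTensor fun φ => ?_
    have h5 := coact_hitRight (isLeftCoaction_comul (k := k) (H := H)) φ h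
    have h6 (s : H ⊗[k] H) : TensorProduct.lid k H (φ.rTensor H ((hitLeft lam).lTensor H s)) =
        hitLeft lam (TensorProduct.lid k H (φ.rTensor H s)) := by
      induction s with
      | zero => simp
      | add s t hs ht => simp only [map_add, hs, ht]
      | tmul c d => simp
    have h7 (s : H ⊗[k] H) : TensorProduct.rid k H (lam.lTensor H
        ((hitRight Δ φ).rTensor H s)) =
        hitRight Δ φ (TensorProduct.rid k H (lam.lTensor H s)) := by
      induction s with
      | zero => simp
      | add s t hs ht => simp only [map_add, hs, ht]
      | tmul c d => simp
    rw [h6, ← hitRight_apply, ← hitRight_apply, hitLeft_apply, hitLeft_apply, h5, h7]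
  refine ⟨⟨g, ⟨?_, ?_⟩⟩, hg⟩
  · simp [g, hε, hLL]
  · have h1 : (hitLeft lam).lTensor H (Δ L) = hitLeft lam L ⊗ₜ g := by
      rw [hitLeft_apply]
      induction Δ L with
      | zero => simp
      | add s t hs ht => simp only [map_add, hs, ht, add_tmul]
      | tmul c d => rw [LinearMap.lTensor_tmul, hg]; simp [smul_tmul]
    change Δ ((lam L)⁻¹ • hitLeft lam L) = _
    rw [map_smul, hΔ, h1, smul_tmul']

/-- The Nakayama automorphism of `H` with respect to a right cointegral:
`λ(S²(w ↼ α) v) = λ(v w)`. -/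
theorem IsRightCointegral.nakayama {lam : H →ₗ[k] k} (hlam : IsRightCointegral lam)
    (hlam0 : lam ≠ 0) {L : H} (hL : IsLeftIntegral (k := k) L) (hL0 : L ≠ 0)
    {α : H →ₐ[k] k} (hα : IsLeftModularFunction L α) (v w : H) :
    lam (𝑺 (𝑺 (hitRight Δ α.toLinearMap w)) * v) = lam (v * w) := by
  have hLL := cointegral_integral_ne_zero hlam hlam0 hL hL0
  -- Let λ(u z) = λ(z w). Then λ(Λ) u = λ(u Λ₍₁₎) S(Λ₍₂₎) = λ(Λ₍₁₎ w) S(Λ₍₂₎), which is evaluated by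
  -- moving w to the second leg of Δ(Λ).
  obtain ⟨u, hu⟩ := hlam.exists_eq hlam0 (lam ∘ₗ LinearMap.mulRight k w)
  suffices u = 𝑺 (𝑺 (hitRight Δ α.toLinearMap w)) by
    rw [← this, ← hu]
    rfl
  let F : H ⊗[k] H →ₗ[k] H := (TensorProduct.lid k H).toLinearMap ∘ₗ TensorProduct.map lam 𝑺
  have hF (c : H) : coactConv Δ (Algebra.linearMap k H ∘ₗ lam ∘ₗ LinearMap.mulLeft k c) 𝑺 L =
      F ((c ⊗ₜ 1) * Δ L) := by
    rw [coactConv_apply]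
    induction Δ L with
    | zero => simp
    | add s t hs ht => simp only [map_add, mul_add, hs, ht]
    | tmul c d => simp [F, Algebra.smul_def]
  have h1 : F (Δ L * (w ⊗ₜ 1)) = F ((u ⊗ₜ 1) * Δ L) := by
    induction Δ L with
    | zero => simp
    | add s t hs ht => simp only [map_add, add_mul, mul_add, hs, ht]
    | tmul c d => simp [F, ← hu]
  rw [← hF, coactConv_integral hlam hL] at h1
  let ι : H →ₐ[k] H ⊗[k] H := Algebra.TensorProduct.includeRight
  let G : H →ₗ[k] H ⊗[k] H := LinearMap.mulLeft k (Δ L) ∘ₗ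
    (Algebra.TensorProduct.includeLeft (R := k) (S := k) (A := H) (B := H)).toLinearMap
  let K : H →ₗ[k] H ⊗[k] H := α.toLinearMap.smulRight (Δ L)
  -- This is Δ(Λ z) = α(z) Δ(Λ); cancelling the second leg of Δ(z) by S gives `h2`.
  have hG : coactConv Δ G ι.toLinearMap = K := by
    ext z
    have key (s : H ⊗[k] H) : LinearMap.mul' k _ (TensorProduct.map G ι.toLinearMap s) =
        Δ L * s := by
      induction s with
      | zero => simp
      | add s t hs ht => simp only [map_add, mul_add, hs, ht]
      | tmul c d => simp [G, ι, mul_assoc]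
    rw [coactConv_apply, key, ← Bialgebra.comul_mul, hα]
    simp [K]
  have h2 : Δ L * (w ⊗ₜ 1) = Δ L * (1 ⊗ₜ 𝑺 (hitRight Δ α.toLinearMap w)) := by
    refine (LinearMap.congr_fun (eq_coactConv_antipode ι hG) w).trans ?_
    rw [coactConv_apply, hitRight_apply]
    induction Δ w with
    | zero => simp
    | add s t hs ht => simp only [map_add, tmul_add, mul_add, hs, ht]
    | tmul c d => simp [K, ι]
  have h3 (y : H) : F (Δ L * (1 ⊗ₜ y)) = 𝑺 y * F ((1 ⊗ₜ 1) * Δ L) := by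
    induction Δ L with
    | zero => simp
    | add s t hs ht => simp only [map_add, add_mul, mul_add, hs, ht]
    | tmul c d => simp [F, HopfAlgebra.antipode_mul_antidistrib]
  rw [h2, h3, ← hF, coactConv_integral hlam hL, mul_smul_comm, mul_one] at h1
  exact (smul_right_injective H hLL h1).symm

/-- The distinguished grouplike element commutes with all grouplike elements. -/
theorem IsDistinguishedGrouplike.commute {lam : H →ₗ[k] k} (hlam : IsRightCointegral lam)
    (hlam0 : lam ≠ 0) {L : H} (hL : IsLeftIntegral (k := k) L) (hL0 : L ≠ 0)
    {g : GroupLike k H} (hg : IsDistinguishedGrouplike lam g) (x : GroupLike k H) :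
    x * g = g * x := by
  have hLL := cointegral_integral_ne_zero hlam hlam0 hL hL0
  let y := x⁻¹
  have hxy : (x : H) * (y : H) = 1 := val_mul_val_inv x
  have hyx : (y : H) * (x : H) = 1 := val_inv_mul_val x
  -- Conjugating λ by x gives a right cointegral, hence a multiple of λ. Its distinguished grouplike
  -- is x⁻¹ g x, which must therefore equal g.
  let μ : H →ₗ[k] k := lam ∘ₗ LinearMap.mulLeft k (x : H) ∘ₗ LinearMap.mulRight k (y : H)
  have hconj (h : H) : Δ (x * (h * y)) = ((x : H) ⊗ₜ (x : H)) * (Δ h * ((y : H) ⊗ₜ (y : H))) := by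
    rw [Bialgebra.comul_mul, Bialgebra.comul_mul, x.2.comul_eq_tmul_self, y.2.comul_eq_tmul_self]
  have hμ : IsRightCointegral μ := by
    intro h
    have h1 : TensorProduct.lid k H (μ.rTensor H (Δ h)) =
        y * TensorProduct.lid k H (lam.rTensor H (Δ (x * (h * y)))) * x := by
      rw [hconj]
      induction Δ h with
      | zero => simp
      | add s t hs ht => simp only [map_add, add_mul, mul_add, hs, ht]
      | tmul c d =>
        simp only [LinearMap.rTensor_tmul, TensorProduct.lid_tmul,
          Algebra.TensorProduct.tmul_mul_tmul, mul_smul_comm, smul_mul_assoc, μ,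
          LinearMap.comp_apply, LinearMap.mulLeft_apply, LinearMap.mulRight_apply]
        rw [mul_assoc (y : H), mul_assoc (x : H), mul_assoc d, hyx, mul_one, ← mul_assoc (y : H), hyx,
          one_mul]
    rw [h1, hlam]
    simp [hyx, μ]
  have h2 := hlam.eq_smul hlam0 hL hμ
  have hc : lam (x * (L * y)) ≠ 0 := by
    intro h0
    refine hlam0 (LinearMap.ext fun z => ?_)
    have := h2 (y * (z * x))
    simp only [μ, LinearMap.comp_apply, LinearMap.mulLeft_apply, LinearMap.mulRight_apply, h0,
      zero_mul, mul_eq_zero, hLL, false_or] at this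
    rwa [mul_assoc (y : H), mul_assoc z, hxy, mul_one, ← mul_assoc, hxy, one_mul] at this
  have h3 : TensorProduct.rid k H (μ.lTensor H (Δ L)) =
        y * TensorProduct.rid k H (lam.lTensor H (Δ (x * (L * y)))) * x := by
    rw [hconj]
    induction Δ L with
    | zero => simp
    | add s t hs ht => simp only [map_add, add_mul, mul_add, hs, ht]
    | tmul c d =>
      simp only [LinearMap.lTensor_tmul, TensorProduct.rid_tmul,
        Algebra.TensorProduct.tmul_mul_tmul, mul_smul_comm, smul_mul_assoc, μ,
        LinearMap.comp_apply, LinearMap.mulLeft_apply, LinearMap.mulRight_apply]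
      rw [mul_assoc (y : H), mul_assoc (x : H), mul_assoc c, hyx, mul_one, ← mul_assoc (y : H), hyx,
        one_mul]
  have h4 : lam L • μ = μ L • lam := LinearMap.ext h2
  have h5 : lam L • TensorProduct.rid k H (μ.lTensor H (Δ L)) =
      μ L • TensorProduct.rid k H (lam.lTensor H (Δ L)) := by
    rw [← map_smul, ← LinearMap.smul_apply, ← LinearMap.lTensor_smul, h4, LinearMap.lTensor_smul,
      LinearMap.smul_apply, map_smul]
  rw [h3, hg, hg] at h5
  have h6 : (lam L * lam (x * (L * y))) • ((y : H) * g * x) =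
      (lam L * lam (x * (L * y))) • (g : H) := by
    simpa [smul_smul, μ, mul_comm] using h5
  have h7 := smul_right_injective H (mul_ne_zero hLL hc) h6
  apply GroupLike.val_injective
  rw [GroupLike.val_mul, GroupLike.val_mul]
  nth_rewrite 1 [← h7]
  rw [← mul_assoc, ← mul_assoc, hxy, one_mul]

end Cointegral

end

noncomputable section

/-! ### Dual bases and the Casimir element of a Frobenius trace. -/

section Frobenius

variable {k A : Type u} [Field k] [Ring A] [Algebra k A] {lam : A →ₗ[k] k}

namespace IsFrobeniusTrace

/-- The isomorphism `a ↦ λ(a -)` from `A` to its dual space. -/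
def toDual (h : IsFrobeniusTrace lam) : A ≃ₗ[k] Module.Dual k A :=
  LinearEquiv.ofBijective ((LinearMap.mul k A).compr₂ lam) h

theorem apply_toDual_symm (h : IsFrobeniusTrace lam) (φ : Module.Dual k A) (b : A) :
    lam (h.toDual.symm φ * b) = φ b :=
  LinearMap.congr_fun (h.toDual.apply_symm_apply φ) b

theorem ext (h : IsFrobeniusTrace lam) {a a' : A} (haa' : ∀ b, lam (a * b) = lam (a' * b)) :
    a = a' :=
  h.1 (LinearMap.ext haa')

variable [FiniteDimensional k A]

/-- The basis of `A` dual to a fixed basis with respect to the Frobenius trace. -/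
def dualBasis (h : IsFrobeniusTrace lam) (i : Fin (Module.finrank k A)) : A :=
  h.toDual.symm ((Module.finBasis k A).coord i)

theorem sum_dualBasis_smul_basis (h : IsFrobeniusTrace lam) (y : A) :
    ∑ i, lam (h.dualBasis i * y) • Module.finBasis k A i = y := by
  simp_rw [dualBasis, h.apply_toDual_symm]
  exact (Module.finBasis k A).sum_repr y

theorem sum_basis_smul_dualBasis (h : IsFrobeniusTrace lam) (y : A) :
    ∑ i, lam (y * Module.finBasis k A i) • h.dualBasis i = y := by
  refine h.ext fun b => ?_
  simp_rw [Finset.sum_mul, map_sum, smul_mul_assoc, map_smul, smul_eq_mul, dualBasis,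
    h.apply_toDual_symm]
  conv_rhs => rw [← (Module.finBasis k A).sum_repr b, Finset.mul_sum, map_sum]
  refine Finset.sum_congr rfl fun i _ => ?_
  simp [mul_comm]

theorem ext' (h : IsFrobeniusTrace lam) {a a' : A} (haa' : ∀ b, lam (b * a) = lam (b * a')) :
    a = a' := by
  rw [← h.sum_dualBasis_smul_basis a, ← h.sum_dualBasis_smul_basis a']
  simp_rw [haa']

theorem exists_nakayama (h : IsFrobeniusTrace lam) :
    ∃ ν : A ≃ₐ[k] A, IsNakayamaAutomorphism lam ν := by
  let ν : A →ₗ[k] A := h.toDual.symm.toLinearMap ∘ₗ (LinearMap.mul k A).flip.compr₂ lam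
  have hν (a b : A) : lam (ν a * b) = lam (b * a) := h.apply_toDual_symm _ b
  let ν' : A →ₐ[k] A := AlgHom.ofLinearMap ν (h.ext fun b => by simp [hν])
    (fun a a' => h.ext fun b => by
      rw [hν, mul_assoc (ν a), hν, mul_assoc, hν, mul_assoc])
  have hinj : Function.Injective ν' := fun a a' haa' => h.ext' fun b => by
    rw [← hν a b, ← hν a' b]
    exact congrArg (fun x => lam (x * b)) haa'
  have hsurj : Function.Surjective ν' :=
    (LinearMap.injective_iff_surjective (f := ν'.toLinearMap)).1 hinj
  exact ⟨AlgEquiv.ofBijective ν' ⟨hinj, hsurj⟩, fun a b => (hν a b).symm⟩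

/-- The Casimir element is central: `∑ a eᵢ ⊗ eⁱ = ∑ eᵢ ⊗ eⁱ a`. -/
theorem sum_mul_basis {N : Type u} [AddCommGroup N] [Module k N] (h : IsFrobeniusTrace lam)
    (B : A →ₗ[k] A →ₗ[k] N) (a : A) :
    ∑ i, B (a * Module.finBasis k A i) (h.dualBasis i) =
      ∑ i, B (Module.finBasis k A i) (h.dualBasis i * a) := by
  have h1 (i) : B (a * Module.finBasis k A i) (h.dualBasis i) =
      ∑ j, lam (h.dualBasis j * a * Module.finBasis k A i) •
        B (Module.finBasis k A j) (h.dualBasis i) := by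
    conv_lhs => rw [← h.sum_dualBasis_smul_basis (a * Module.finBasis k A i)]
    simp [mul_assoc]
  simp_rw [h1]
  rw [Finset.sum_comm]
  refine Finset.sum_congr rfl fun j _ => ?_
  conv_rhs => rw [← h.sum_basis_smul_dualBasis (h.dualBasis j * a)]
  simp

/-- Expand eᵢ a in the basis: its coefficients λ(eʲ eᵢ a) equal λ(ν(a) eʲ eᵢ), which are also the
coefficients of ν(a) eʲ in the dual basis. -/
theorem sum_basis_mul {N : Type u} [AddCommGroup N] [Module k N] (h : IsFrobeniusTrace lam)
    {ν : A ≃ₐ[k] A} (hν : IsNakayamaAutomorphism lam ν) (B : A →ₗ[k] A →ₗ[k] N) (a : A) :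
    ∑ i, B (Module.finBasis k A i * a) (h.dualBasis i) =
      ∑ i, B (Module.finBasis k A i) (ν a * h.dualBasis i) := by
  have h1 (i) : B (Module.finBasis k A i * a) (h.dualBasis i) =
      ∑ j, lam (ν a * h.dualBasis j * Module.finBasis k A i) •
        B (Module.finBasis k A j) (h.dualBasis i) := by
    conv_lhs => rw [← h.sum_dualBasis_smul_basis (Module.finBasis k A i * a)]
    simp [← mul_assoc, hν a]
  simp_rw [h1]
  rw [Finset.sum_comm]
  refine Finset.sum_congr rfl fun j _ => ?_
  conv_rhs => rw [← h.sum_basis_smul_dualBasis (ν a * h.dualBasis j)]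
  simp

variable {H : Type u} [Ring H] [HopfAlgebra k H]

theorem tensor_expand (h : IsFrobeniusTrace lam) (s : H ⊗[k] A) :
    s = ∑ i, TensorProduct.rid k H (lam.lTensor H ((1 ⊗ₜ h.dualBasis i) * s)) ⊗ₜ
      Module.finBasis k A i := by
  induction s with
  | zero => simp
  | add s t hs ht =>
    conv_lhs => rw [hs, ht]
    simp only [mul_add, map_add, add_tmul, Finset.sum_add_distrib]
  | tmul c a =>
    conv_lhs => rw [← h.sum_dualBasis_smul_basis a]
    simp [tmul_sum, smul_tmul']

theorem tensor_ext (h : IsFrobeniusTrace lam) {s t : H ⊗[k] A}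
    (hst : ∀ b : A, TensorProduct.rid k H (lam.lTensor H (s * (1 ⊗ₜ b))) =
      TensorProduct.rid k H (lam.lTensor H (t * (1 ⊗ₜ b)))) : s = t := by
  have key (s : H ⊗[k] A) :
      s = ∑ i, TensorProduct.rid k H (lam.lTensor H (s * (1 ⊗ₜ Module.finBasis k A i))) ⊗ₜ
        h.dualBasis i := by
    induction s with
    | zero => simp
    | add s t hs ht =>
      conv_lhs => rw [hs, ht]
      simp only [add_mul, map_add, add_tmul, Finset.sum_add_distrib]
    | tmul c a =>
      conv_lhs => rw [← h.sum_basis_smul_dualBasis a]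
      simp [tmul_sum, smul_tmul']
  rw [key s, key t]
  simp_rw [hst]

end IsFrobeniusTrace

end Frobenius

/-! ### Grouplike-cointegrals on a comodule algebra. -/

section GCointegral

variable {k H A : Type u} [Field k] [Ring H] [HopfAlgebra k H] [Ring A] [Algebra k A]
  {δ : LeftComoduleAlgebra k H A} {g : GroupLike k H} {lam : A →ₗ[k] k}

local notation "𝑺" => HopfAlgebra.antipode k (A := H)

/-- `b₍₋₁₎ λ(a b₍₀₎) = S(a₍₋₁₎) g λ(a₍₀₎ b)`. -/
theorem IsGCointegral.slice (hlam : IsGCointegral δ g lam) (a b : A) :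
    TensorProduct.rid k H (lam.lTensor H ((1 ⊗ₜ a) * δ.coact b)) =
      𝑺 (TensorProduct.rid k H (lam.lTensor H (δ.coact a * (1 ⊗ₜ b)))) * g := by
  let G : A →ₗ[k] H := (TensorProduct.rid k H).toLinearMap ∘ₗ lam.lTensor H ∘ₗ
    LinearMap.mulRight k (δ.coact b) ∘ₗ
    (Algebra.TensorProduct.includeRight (R := k) (A := H) (B := A)).toLinearMap
  let K : A →ₗ[k] H := (lam ∘ₗ LinearMap.mulRight k b).smulRight (g : H)
  -- The cointegral property at the product: a₍₋₁₎ b₍₋₁₎ λ(a₍₀₎ b₍₀₎) = λ(a b) g. The antipode then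
  -- removes a₍₋₁₎.
  have hG : coactConv δ.coact.toLinearMap (AlgHom.id k H).toLinearMap G = K := by
    ext a
    have key (s : H ⊗[k] A) : LinearMap.mul' k _
        (TensorProduct.map (AlgHom.id k H).toLinearMap G s) =
        TensorProduct.rid k H (lam.lTensor H (s * δ.coact b)) := by
      induction s with
      | zero => simp
      | add s t hs ht => simp only [map_add, add_mul, hs, ht]
      | tmul c a =>
        simp only [G, TensorProduct.map_tmul, LinearMap.mul'_apply, LinearMap.comp_apply,
          AlgHom.toLinearMap_apply, Algebra.TensorProduct.includeRight_apply,
          LinearMap.mulRight_apply, LinearEquiv.coe_coe, AlgHom.id_apply]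
        induction δ.coact b with
        | zero => simp
        | add s t hs ht => simp only [map_add, mul_add, hs, ht]
        | tmul d b => simp
    rw [coactConv_apply, AlgHom.toLinearMap_apply, key, ← map_mul, hlam]
    rfl
  refine (LinearMap.congr_fun (eq_antipode_coactConv δ.isLeftCoaction (AlgHom.id k H) hG) a).trans
    ?_
  rw [coactConv_apply, AlgHom.toLinearMap_apply]
  induction δ.coact a with
  | zero => simp
  | add s t hs ht => simp only [map_add, add_mul, hs, ht]
  | tmul c a => simp [K]

variable [FiniteDimensional k A]

/-- `S²(ν(a)₍₋₁₎) ⊗ ν(a)₍₀₎ = g a₍₋₁₎ g⁻¹ ⊗ ν(a₍₀₎)`. -/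
theorem IsGCointegral.coact_nakayama (hlam : IsGCointegral δ g lam) (h : IsFrobeniusTrace lam)
    {ν : A ≃ₐ[k] A} (hν : IsNakayamaAutomorphism lam ν) (a : A) :
    (𝑺 ∘ₗ 𝑺).rTensor A (δ.coact (ν a)) =
      TensorProduct.map (LinearMap.mulLeft k (g : H) ∘ₗ
        LinearMap.mulRight k ((g⁻¹ : GroupLike k H) : H)) ν.toLinearMap (δ.coact a) := by
  refine h.tensor_ext fun b => ?_
  -- Slicing at (ν(a), b) and at (b, a) gives the two sides of the identity, linked by λ(ν(a) b₍₀₎)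
  -- = λ(b₍₀₎ a); two applications of `slice` produce S² and the conjugation by g.
  have h1 := hlam.slice (ν a) b
  have h2 := hlam.slice b a
  have h3 : TensorProduct.rid k H (lam.lTensor H ((1 ⊗ₜ ν a) * δ.coact b)) =
      TensorProduct.rid k H (lam.lTensor H (δ.coact b * (1 ⊗ₜ a))) := by
    induction δ.coact b with
    | zero => simp
    | add s t hs ht => simp only [map_add, mul_add, add_mul, hs, ht]
    | tmul c b => simp [← hν a b]
  rw [← h3, h1, HopfAlgebra.antipode_mul_antidistrib] at h2
  have h4 : TensorProduct.rid k H (lam.lTensor H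
      ((𝑺 ∘ₗ 𝑺).rTensor A (δ.coact (ν a)) * (1 ⊗ₜ b))) =
      𝑺 (𝑺 (TensorProduct.rid k H (lam.lTensor H (δ.coact (ν a) * (1 ⊗ₜ b))))) := by
    induction δ.coact (ν a) with
    | zero => simp
    | add s t hs ht => simp only [map_add, add_mul, hs, ht]
    | tmul c b => simp
  have h5 : TensorProduct.rid k H (lam.lTensor H
      (TensorProduct.map (LinearMap.mulLeft k (g : H) ∘ₗ
        LinearMap.mulRight k ((g⁻¹ : GroupLike k H) : H)) ν.toLinearMap (δ.coact a) *
          (1 ⊗ₜ b))) =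
      g * TensorProduct.rid k H (lam.lTensor H ((1 ⊗ₜ b) * δ.coact a)) *
        ((g⁻¹ : GroupLike k H) : H) := by
    induction δ.coact a with
    | zero => simp
    | add s t hs ht => simp only [map_add, mul_add, add_mul, hs, ht]
    | tmul c a => simp [hν a b, mul_assoc]
  rw [h4, h5, h2, ← GroupLike.val_inv, mul_assoc, mul_assoc, mul_assoc, val_mul_val_inv, mul_one,
    ← mul_assoc, val_mul_val_inv, one_mul]

/-- Apply α to the H-leg of `coact_nakayama`: a character does not see conjugation by g, nor S². -/
theorem IsGCointegral.hitRight_nakayama (hlam : IsGCointegral δ g lam) (h : IsFrobeniusTrace lam)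
    {ν : A ≃ₐ[k] A} (hν : IsNakayamaAutomorphism lam ν) (α : H →ₐ[k] k) (a : A) :
    hitRight δ.coact.toLinearMap α.toLinearMap (ν a) =
      ν (hitRight δ.coact.toLinearMap α.toLinearMap a) := by
  have h1 := congrArg (fun s => TensorProduct.lid k A (α.toLinearMap.rTensor A s))
    (hlam.coact_nakayama h hν a)
  have h2 : α.toLinearMap ∘ₗ 𝑺 ∘ₗ 𝑺 = α.toLinearMap :=
    LinearMap.ext (algHom_antipode_antipode α)
  have h3 (x : H) : α g * (α x * α (𝑺 g)) = α x := by
    rw [← GroupLike.val_inv, mul_comm (α x), ← mul_assoc, ← map_mul, val_mul_val_inv, map_one,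
      one_mul]
  rw [← LinearMap.comp_apply, ← LinearMap.rTensor_comp, h2] at h1
  refine h1.trans ?_
  rw [hitRight_apply, AlgHom.toLinearMap_apply]
  induction δ.coact a with
  | zero => simp
  | add s t hs ht => simp only [map_add, hs, ht]
  | tmul c a => simp [h3]

/-- Nondegeneracy of the twisted pairing `(h ⊗ a, b) ↦ h b₍₋₁₎ λ(a b₍₀₎)`. -/
theorem tensor_ext_coact (hS : Function.Injective 𝑺)
    (h : IsFrobeniusTrace lam) {s t : H ⊗[k] A}
    (hst : ∀ b : A, TensorProduct.rid k H (lam.lTensor H (s * δ.coact b)) =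
      TensorProduct.rid k H (lam.lTensor H (t * δ.coact b))) : s = t := by
  rw [← sub_eq_zero]
  have hs (b : A) : TensorProduct.rid k H (lam.lTensor H ((s - t) * δ.coact b)) = 0 := by
    rw [sub_mul, map_sub, map_sub, hst, sub_self]
  generalize s - t = s at hs
  -- In the pairing b₍₋₁₎ multiplies from the right. Applying S reverses the product, so that
  -- S(b₍₋₁₎) acts from the left and can be cancelled by convolution.
  let G : A →ₗ[k] H := 𝑺 ∘ₗ (TensorProduct.rid k H).toLinearMap ∘ₗ lam.lTensor H ∘ₗ
    LinearMap.mulLeft k s ∘ₗ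
    (Algebra.TensorProduct.includeRight (R := k) (A := H) (B := A)).toLinearMap
  have hG : coactConv δ.coact.toLinearMap ((AlgHom.id k H).toLinearMap ∘ₗ 𝑺) G = 0 := by
    ext b
    have key (t : H ⊗[k] A) : LinearMap.mul' k _
        (TensorProduct.map ((AlgHom.id k H).toLinearMap ∘ₗ 𝑺) G t) =
        𝑺 (TensorProduct.rid k H (lam.lTensor H (s * t))) := by
      induction t with
      | zero => simp
      | add s t hs ht => simp only [map_add, mul_add, hs, ht]
      | tmul c a =>
        simp only [G, TensorProduct.map_tmul, LinearMap.mul'_apply, LinearMap.comp_apply,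
          AlgHom.toLinearMap_apply, Algebra.TensorProduct.includeRight_apply,
          LinearMap.mulLeft_apply, LinearEquiv.coe_coe, AlgHom.id_apply]
        rw [← HopfAlgebra.antipode_mul_antidistrib]
        congr 1
        clear hs hst G
        induction s with
        | zero => simp
        | add s t hs ht => simp only [map_add, add_mul, hs, ht]
        | tmul d b => simp
    rw [coactConv_apply, AlgHom.toLinearMap_apply, key, hs]
    simp
  have hG0 := eq_zero_of_antipode_coactConv δ.isLeftCoaction (AlgHom.id k H) hG
  refine h.tensor_ext fun b => hS ?_
  have := LinearMap.congr_fun hG0 b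
  simpa [G] using this

end GCointegral

end

noncomputable section

/-! ### Averaging onto central coinvariant elements. -/

section Averaging

variable {k H A : Type u} [Field k] [Ring H] [HopfAlgebra k H] [Ring A] [Algebra k A]
  {δ : LeftComoduleAlgebra k H A}

local notation "𝑺" => HopfAlgebra.antipode k (A := H)

theorem coactConv_antipode_coact (b : A) :
    coactConv δ.coact.toLinearMap
      ((Algebra.TensorProduct.includeLeft (R := k) (S := k) (A := H) (B := A)).toLinearMap ∘ₗ 𝑺)
      δ.coact.toLinearMap b = 1 ⊗ₜ b := by
  have h1 : coactConv δ.coact.toLinearMap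
      (Algebra.TensorProduct.includeLeft (R := k) (S := k) (A := H) (B := A)).toLinearMap
      (Algebra.TensorProduct.includeRight (R := k) (A := H) (B := A)).toLinearMap =
      δ.coact.toLinearMap := by
    ext b
    rw [coactConv_apply, AlgHom.toLinearMap_apply]
    induction δ.coact b with
    | zero => simp
    | add s t hs ht => simp only [map_add, hs, ht]
    | tmul c a => simp
  exact (LinearMap.congr_fun (eq_antipode_coactConv δ.isLeftCoaction _ h1) b).symm

theorem toLin_hitRight {X Y : HopfBimod δ} (f : X ⟶ Y) (φ : H →ₗ[k] k) (x : X) :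
    HopfBimod.toLin f (hitRight X.str.coact φ x) =
      hitRight Y.str.coact φ (HopfBimod.toLin f x) := by
  have h := f.2.2.2 x
  change Y.str.coact (HopfBimod.toLin f x) = (HopfBimod.toLin f).lTensor H (X.str.coact x) at h
  rw [hitRight_apply, hitRight_apply, h]
  induction X.str.coact x with
  | zero => simp
  | add s t hs ht => simp only [map_add, hs, ht]
  | tmul c a => simp

variable [FiniteDimensional k A]

/-- The morphism `A → X`, `a ↦ a m`, for a central coinvariant element `m` of `X`. -/
def homOfCentral (X : HopfBimod δ) (m : X) (hm : ∀ a : A, X.str.lact a m = X.str.ract m a)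
    (hm' : X.str.coact m = 1 ⊗ₜ m) : unitObj δ ⟶ X :=
  have h1 (a b : A) : X.str.lact (a * b) m = X.str.lact a (X.str.lact b m) := X.str.mul_lact a b m
  have h2 (a b : A) : X.str.lact (a * b) m = X.str.ract (X.str.lact a m) b := by
    rw [X.str.mul_lact, hm, ← X.str.lact_ract]
  have h3 (a : A) : X.str.coact (X.str.lact a m) =
      (X.str.lact.flip m).lTensor H (δ.coact a) := by
    rw [X.str.coact_lact, hm']
    induction δ.coact a with
    | zero => simp
    | add s t hs ht => simp only [map_add, LinearMap.add_apply, hs, ht]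
    | tmul c a => simp
  ⟨X.str.lact.flip m, h1, h2, h3⟩

theorem toLin_unit_apply {X : HopfBimod δ} (f : unitObj δ ⟶ X) (a : A) :
    HopfBimod.toLin f a = X.str.lact a (HopfBimod.toLin f (1 : A)) := by
  refine Eq.trans ?_ (f.2.1 a (1 : A))
  exact congrArg (HopfBimod.toLin f) (mul_one a).symm

/-- With `homOfCentral`, `toLin_unit_central` and `toLin_unit_coinvariant`, evaluation at 1
identifies Hom(A, X) with the central coinvariant elements of X. -/
theorem unit_hom_ext {X : HopfBimod δ} {f g : unitObj δ ⟶ X}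
    (h : HopfBimod.toLin f (1 : A) = HopfBimod.toLin g (1 : A)) : f = g := by
  ext1
  refine LinearMap.ext fun a => ?_
  exact (toLin_unit_apply f a).trans ((congrArg _ h).trans (toLin_unit_apply g a).symm)

theorem toLin_unit_central {X : HopfBimod δ} (f : unitObj δ ⟶ X) (a : A) :
    X.str.lact a (HopfBimod.toLin f (1 : A)) = X.str.ract (HopfBimod.toLin f (1 : A)) a := by
  rw [← toLin_unit_apply]
  refine Eq.trans ?_ (f.2.2.1 (1 : A) a)
  exact congrArg (HopfBimod.toLin f) (one_mul a).symm

theorem toLin_unit_coinvariant {X : HopfBimod δ} (f : unitObj δ ⟶ X) :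
    X.str.coact (HopfBimod.toLin f (1 : A)) = 1 ⊗ₜ HopfBimod.toLin f (1 : A) := by
  refine (f.2.2.2 (1 : A)).trans ?_
  change f.1.lTensor H (δ.coact 1) = _
  rw [map_one]
  rfl

section Casimir

variable {g : GroupLike k H} {lam : A →ₗ[k] k}

/-- The action `x ↦ ∑ eᵢ x eⁱ` of the Casimir element. -/
def casimir (h : IsFrobeniusTrace lam) (X : HopfBimod δ) : X →ₗ[k] X :=
  ∑ i, X.str.lact (Module.finBasis k A i) ∘ₗ X.str.ract.flip (h.dualBasis i)

theorem casimir_apply (h : IsFrobeniusTrace lam) (X : HopfBimod δ) (x : X) :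
    casimir h X x =
      ∑ i, X.str.lact (Module.finBasis k A i) (X.str.ract x (h.dualBasis i)) := by
  simp [casimir]

theorem casimir_central (h : IsFrobeniusTrace lam) (X : HopfBimod δ) (x : X) (a : A) :
    X.str.lact a (casimir h X x) = X.str.ract (casimir h X x) a := by
  have := h.sum_mul_basis (X.str.lact.compl₂ (X.str.ract x)) a
  simp only [LinearMap.compl₂_apply] at this
  simp only [casimir_apply, map_sum, LinearMap.sum_apply, ← X.str.mul_lact, X.str.lact_ract,
    ← X.str.ract_mul, this]

theorem casimir_lact (h : IsFrobeniusTrace lam) {ν : A ≃ₐ[k] A}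
    (hν : IsNakayamaAutomorphism lam ν) (X : HopfBimod δ) (x : X) (a : A) :
    casimir h X (X.str.lact a x) = casimir h X (X.str.ract x (ν a)) := by
  have := h.sum_basis_mul hν (X.str.lact.compl₂ (X.str.ract x)) a
  simp only [LinearMap.compl₂_apply] at this
  simp only [casimir_apply, ← X.str.mul_lact, X.str.lact_ract, ← X.str.ract_mul, this]

theorem casimir_naturality (h : IsFrobeniusTrace lam) {X Y : HopfBimod δ} (f : X ⟶ Y) (x : X) :
    HopfBimod.toLin f (casimir h X x) = casimir h Y (HopfBimod.toLin f x) := by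
  simp only [casimir_apply, map_sum]
  refine Finset.sum_congr rfl fun i _ => (f.2.1 _ _).trans ?_
  exact congrArg _ (f.2.2.1 _ _)

/-- Expanding δ(eᵢ) by `tensor_expand` and `slice` produces S(eʲ₍₋₁₎) g with weight λ(eʲ₍₀₎ eᵢ).
This g meets the g⁻¹ of x and cancels; summing over i leaves S(eʲ₍₋₂₎) eʲ₍₋₁₎ ⊗ eⱼ x eʲ₍₀₎, where
the H-leg becomes 1. -/
theorem coact_casimir (hlam : IsGCointegral δ g lam) (h : IsFrobeniusTrace lam)
    (X : HopfBimod δ) (x : X) (hx : X.str.coact x = ((g⁻¹ : GroupLike k H) : H) ⊗ₜ x) :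
    X.str.coact (casimir h X x) = 1 ⊗ₜ casimir h X x := by
  let W (s t : H ⊗[k] A) : H ⊗[k] X := TensorProduct.map₂ (LinearMap.mul k H) X.str.lact s
    (TensorProduct.map₂ (LinearMap.mul k H) X.str.ract (((g⁻¹ : GroupLike k H) : H) ⊗ₜ x) t)
  have hW (c : H) (e : A) (t : H ⊗[k] A) : W ((c * g) ⊗ₜ e) t =
      (X.str.lact e ∘ₗ X.str.ract x).lTensor H ((c ⊗ₜ 1) * t) := by
    induction t with
    | zero => simp [W]
    | add s t hs ht =>
      simp only [W] at hs ht
      simp only [W, map_add, mul_add, hs, ht]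
    | tmul d a =>
      simp only [W, TensorProduct.map₂_apply_tmul, LinearMap.mul_apply',
        Algebra.TensorProduct.tmul_mul_tmul, one_mul, LinearMap.lTensor_tmul,
        LinearMap.comp_apply, TensorProduct.map_tmul]
      rw [mul_assoc, ← mul_assoc (g : H), val_mul_val_inv, one_mul]
  have hΩ (e : A) (s : H ⊗[k] A) :
      ∑ i, W ((𝑺 (TensorProduct.rid k H (lam.lTensor H
        (s * (1 ⊗ₜ Module.finBasis k A i)))) * g) ⊗ₜ e) (δ.coact (h.dualBasis i)) =
      (X.str.lact e ∘ₗ X.str.ract x).lTensor H (LinearMap.mul' k _ (TensorProduct.map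
        ((Algebra.TensorProduct.includeLeft (R := k) (S := k) (A := H) (B := A)).toLinearMap ∘ₗ 𝑺)
        δ.coact.toLinearMap s)) := by
    simp_rw [hW]
    induction s with
    | zero => simp
    | add s t hs ht => simp only [add_mul, map_add, add_tmul, Finset.sum_add_distrib, hs, ht]
    | tmul c a =>
      conv_rhs => rw [← h.sum_basis_smul_dualBasis a]
      simp [tmul_sum, ← smul_tmul']
  have h1 : X.str.coact (casimir h X x) =
      ∑ i, W (δ.coact (Module.finBasis k A i)) (δ.coact (h.dualBasis i)) := by
    simp only [casimir_apply, map_sum, X.str.coact_lact, X.str.coact_ract, hx, W]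
  have h2 (i) : W (δ.coact (Module.finBasis k A i)) (δ.coact (h.dualBasis i)) =
      ∑ j, W ((𝑺 (TensorProduct.rid k H (lam.lTensor H (δ.coact (h.dualBasis j) *
        (1 ⊗ₜ Module.finBasis k A i)))) * g) ⊗ₜ Module.finBasis k A j)
        (δ.coact (h.dualBasis i)) := by
    conv_lhs => rw [h.tensor_expand (δ.coact (Module.finBasis k A i))]
    simp only [hlam.slice, W, map_sum, LinearMap.sum_apply]
  rw [h1]
  simp_rw [h2]
  rw [Finset.sum_comm]
  simp_rw [hΩ]
  rw [casimir_apply, tmul_sum]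
  refine Finset.sum_congr rfl fun j _ => ?_
  have h3 := coactConv_antipode_coact (δ := δ) (h.dualBasis j)
  rw [coactConv_apply, AlgHom.toLinearMap_apply] at h3
  rw [h3]
  simp

end Casimir

variable {lamH : H →ₗ[k] k} {lamA : A →ₗ[k] k} {gA gH : GroupLike k H}

/-- The linear form `λ(g -)` for a right cointegral `λ`. -/
def twistedCointegral (lamH : H →ₗ[k] k) (g : GroupLike k H) : H →ₗ[k] k :=
  lamH ∘ₗ LinearMap.mulLeft k (g : H)

/-- The reason for the twist: acting with λ(g -) produces elements with coaction g⁻¹, the input that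
`coact_casimir` requires. -/
theorem hitRight_twistedCointegral (hlamH : IsRightCointegral lamH) (g : GroupLike k H) (h : H) :
    hitRight (Coalgebra.comul (R := k)) (twistedCointegral lamH g) h =
      twistedCointegral lamH g h • ((g⁻¹ : GroupLike k H) : H) := by
  have h1 := hlamH (g * h)
  rw [Bialgebra.comul_mul, g.2.comul_eq_tmul_self] at h1
  have h2 : TensorProduct.lid k H (lamH.rTensor H
      (((g : H) ⊗ₜ (g : H)) * Coalgebra.comul (R := k) h)) =
      g * hitRight (Coalgebra.comul (R := k)) (twistedCointegral lamH g) h := by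
    rw [hitRight_apply]
    induction Coalgebra.comul (R := k) h with
    | zero => simp
    | add s t hs ht => simp only [map_add, mul_add, hs, ht]
    | tmul c a => simp [twistedCointegral]
  rw [h2] at h1
  have h3 := congrArg (fun x => ((g⁻¹ : GroupLike k H) : H) * x) h1
  rw [← mul_assoc, val_inv_mul_val, one_mul, mul_smul_comm, mul_one] at h3
  exact h3

theorem hitLeft_twistedCointegral (hg : IsDistinguishedGrouplike lamH gH) (g : GroupLike k H)
    (h : H) : hitLeft (twistedCointegral lamH g) h =
      twistedCointegral lamH g h • ((g⁻¹ * gH : GroupLike k H) : H) := by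
  have h1 := hg (g * h)
  rw [Bialgebra.comul_mul, g.2.comul_eq_tmul_self] at h1
  have h2 : TensorProduct.rid k H (lamH.lTensor H
      (((g : H) ⊗ₜ (g : H)) * Coalgebra.comul (R := k) h)) =
      g * hitLeft (twistedCointegral lamH g) h := by
    rw [hitLeft_apply]
    induction Coalgebra.comul (R := k) h with
    | zero => simp
    | add s t hs ht => simp only [map_add, mul_add, hs, ht]
    | tmul c a => simp [twistedCointegral]
  rw [h2] at h1
  have h3 := congrArg (fun x => ((g⁻¹ : GroupLike k H) : H) * x) h1
  rw [← mul_assoc, val_inv_mul_val, one_mul, mul_smul_comm, ← GroupLike.val_mul] at h3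
  exact h3

/-- The map `x ↦ ∑ λ_H(g x₍₋₁₎) eᵢ x₍₀₎ eⁱ`, whose values are central and coinvariant. -/
def average (lamH : H →ₗ[k] k) (gA : GroupLike k H) (h : IsFrobeniusTrace lamA)
    (X : HopfBimod δ) : X →ₗ[k] X :=
  casimir h X ∘ₗ hitRight X.str.coact (twistedCointegral lamH gA)

theorem average_apply (h : IsFrobeniusTrace lamA) (X : HopfBimod δ) (x : X) :
    average lamH gA h X x =
      casimir h X (hitRight X.str.coact (twistedCointegral lamH gA) x) := rfl

theorem average_naturality (h : IsFrobeniusTrace lamA) {X Y : HopfBimod δ} (f : X ⟶ Y) (x : X) :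
    HopfBimod.toLin f (average lamH gA h X x) = average lamH gA h Y (HopfBimod.toLin f x) := by
  rw [average_apply, average_apply, casimir_naturality, toLin_hitRight]

theorem coact_average (hlamH : IsRightCointegral lamH) (hlam : IsGCointegral δ gA lamA)
    (h : IsFrobeniusTrace lamA) (X : HopfBimod δ) (x : X) :
    X.str.coact (average lamH gA h X x) = 1 ⊗ₜ average lamH gA h X x := by
  refine coact_casimir hlam h X _ ?_
  rw [coact_hitRight X.str.isLeftCoaction, hitRight_apply]
  induction X.str.coact x with
  | zero => simp
  | add s t hs ht => simp only [map_add, tmul_add, hs, ht]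
  | tmul c a => simp [hitRight_twistedCointegral hlamH, smul_tmul]

theorem lTensor_average (hg : IsDistinguishedGrouplike lamH gH) (h : IsFrobeniusTrace lamA)
    (X : HopfBimod δ) (x : X) :
    (average lamH gA h X).lTensor H (X.str.coact x) =
      ((gA⁻¹ * gH : GroupLike k H) : H) ⊗ₜ average lamH gA h X x := by
  rw [average, LinearMap.lTensor_comp, LinearMap.comp_apply,
    lTensor_hitRight X.str.isLeftCoaction, LinearMap.comp_apply, hitRight_apply]
  induction X.str.coact x with
  | zero => simp
  | add s t hs ht => simp only [map_add, tmul_add, hs, ht]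
  | tmul c a =>
    rw [LinearMap.rTensor_tmul, hitLeft_twistedCointegral hg]
    simp [smul_tmul]

/-- The Nakayama automorphism of λ_H moves ν(a)₍₋₁₎ to the front as S²(ν(a)₍₋₁₎ ↼ α). With d = a ↼
α, `coact_nakayama` turns this into g d₍₋₁₎ g⁻¹, whose g⁻¹ cancels the twist g, and leaves ν(d₍₀₎)
on the right, which `casimir_lact` moves to the left as d₍₀₎. -/
theorem average_ract_nakayama [FiniteDimensional k H] (hlamH : IsRightCointegral lamH) (hlamH0 : lamH ≠ 0)
    {L : H} (hL : IsLeftIntegral (k := k) L) (hL0 : L ≠ 0) {α : H →ₐ[k] k}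
    (hα : IsLeftModularFunction L α) (hlam : IsGCointegral δ gA lamA) (h : IsFrobeniusTrace lamA)
    {ν : A ≃ₐ[k] A} (hν : IsNakayamaAutomorphism lamA ν) (X : HopfBimod δ) (x : X) (a : A) :
    average lamH gA h X (X.str.ract x (ν a)) =
      average lamH gA h X
        (X.str.lact (hitRight δ.coact.toLinearMap α.toLinearMap a) x) := by
  -- The common form of both sides: (b ⊗ c, d ⊗ y) ↦ λ_H(b d) ∑ eᵢ y c eⁱ.
  let V : H ⊗[k] A →ₗ[k] H ⊗[k] X →ₗ[k] X :=
    (TensorProduct.map₂ (LinearMap.mul k H) X.str.ract.flip).compr₂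
      (casimir h X ∘ₗ (TensorProduct.lid k X).toLinearMap ∘ₗ lamH.rTensor X)
  have hV (b : H) (c : A) (d : H) (y : X) : V (b ⊗ₜ c) (d ⊗ₜ y) =
      lamH (b * d) • casimir h X (X.str.ract y c) := by simp [V]
  let E : H →ₗ[k] H := 𝑺 ∘ₗ 𝑺 ∘ₗ hitRight (Coalgebra.comul (R := k)) α.toLinearMap
  have h1 (s : H ⊗[k] X) (t : H ⊗[k] A) :
      casimir h X (TensorProduct.lid k X ((twistedCointegral lamH gA).rTensor X
        (TensorProduct.map₂ (LinearMap.mul k H) X.str.ract s t))) =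
      V (E.rTensor A t) ((LinearMap.mulLeft k (gA : H)).rTensor X s) := by
    induction s with
    | zero => simp
    | add s s' hs hs' => simp only [map_add, LinearMap.add_apply, hs, hs']
    | tmul d y =>
      induction t with
      | zero => simp
      | add t t' ht ht' => simp only [map_add, LinearMap.add_apply, ht, ht']
      | tmul b c =>
        simp only [LinearMap.rTensor_tmul, hV, E, LinearMap.comp_apply, LinearMap.mulLeft_apply,
          hlamH.nakayama hlamH0 hL hL0 hα]
        simp [twistedCointegral, mul_assoc]
  have h2 (d : A) (s : H ⊗[k] X) : V (TensorProduct.map (LinearMap.mulLeft k (gA : H) ∘ₗ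
        LinearMap.mulRight k ((gA⁻¹ : GroupLike k H) : H)) ν.toLinearMap (δ.coact d))
        ((LinearMap.mulLeft k (gA : H)).rTensor X s) =
      casimir h X (TensorProduct.lid k X ((twistedCointegral lamH gA).rTensor X
        (TensorProduct.map₂ (LinearMap.mul k H) X.str.lact (δ.coact d) s))) := by
    induction s with
    | zero => simp
    | add s s' hs hs' => simp only [map_add, hs, hs']
    | tmul e y =>
      induction δ.coact d with
      | zero => simp
      | add t t' ht ht' => simp only [map_add, LinearMap.add_apply, ht, ht']
      | tmul b c =>
        simp only [LinearMap.rTensor_tmul, TensorProduct.map_tmul, hV, LinearMap.comp_apply,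
          LinearMap.mulLeft_apply, LinearMap.mulRight_apply, TensorProduct.map₂_apply_tmul,
          LinearMap.mul_apply', TensorProduct.lid_tmul, map_smul, casimir_lact h hν,
          twistedCointegral]
        rw [mul_assoc (gA : H), mul_assoc b, ← mul_assoc _ (gA : H) e, val_inv_mul_val, one_mul]
        rfl
  rw [average_apply, average_apply, hitRight_apply, hitRight_apply, X.str.coact_ract,
    X.str.coact_lact, h1, ← h2, ← hlam.coact_nakayama h hν, ← hlam.hitRight_nakayama h hν]
  have h3 := coact_hitRight δ.isLeftCoaction α.toLinearMap (ν a)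
  rw [AlgHom.toLinearMap_apply, AlgHom.toLinearMap_apply] at h3
  rw [h3, ← LinearMap.comp_apply (LinearMap.rTensor A _), ← LinearMap.rTensor_comp]
  rfl

/-- The natural transformation `X → Hom(A, X)`. -/
def averageHom (hlamH : IsRightCointegral lamH) (hlam : IsGCointegral δ gA lamA)
    (h : IsFrobeniusTrace lamA) (X : HopfBimod δ) : X →ₗ[k] (unitObj δ ⟶ X) where
  toFun x := homOfCentral X (average lamH gA h X x) (casimir_central h X _)
    (coact_average hlamH hlam h X x)
  map_add' x y := unit_hom_ext (by
    change X.str.lact 1 _ = X.str.lact 1 _ + X.str.lact 1 _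
    rw [map_add, map_add])
  map_smul' c x := unit_hom_ext (by
    change X.str.lact 1 _ = c • X.str.lact 1 _
    rw [map_smul, map_smul])

theorem toLin_averageHom (hlamH : IsRightCointegral lamH) (hlam : IsGCointegral δ gA lamA)
    (h : IsFrobeniusTrace lamA) (X : HopfBimod δ) (x : X) :
    HopfBimod.toLin (averageHom hlamH hlam h X x) (1 : A) = average lamH gA h X x :=
  X.str.one_lact _

theorem averageHom_naturality (hlamH : IsRightCointegral lamH) (hlam : IsGCointegral δ gA lamA)
    (h : IsFrobeniusTrace lamA) {X Y : HopfBimod δ} (f : X ⟶ Y) (x : X) :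
    averageHom hlamH hlam h X x ≫ f = averageHom hlamH hlam h Y (HopfBimod.toLin f x) :=
  unit_hom_ext ((congrArg (HopfBimod.toLin f) (toLin_averageHom hlamH hlam h X x)).trans
    ((average_naturality h f x).trans (toLin_averageHom hlamH hlam h Y _).symm))

end Averaging

end

noncomputable section

/-! ### Diagonal coactions on tensor products. -/

section TensorCoaction

variable {k H M N : Type u} [Field k] [Ring H] [HopfAlgebra k H] [AddCommGroup M] [Module k M]
  [AddCommGroup N] [Module k N]

/-- The diagonal coaction `m ⊗ n ↦ m₍₋₁₎ n₍₋₁₎ ⊗ (m₍₀₎ ⊗ n₍₀₎)`. -/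
def tensorCoact (δM : M →ₗ[k] H ⊗[k] M) (δN : N →ₗ[k] H ⊗[k] N) :
    M ⊗[k] N →ₗ[k] H ⊗[k] (M ⊗[k] N) :=
  TensorProduct.lift ((TensorProduct.map₂ (LinearMap.mul k H) (TensorProduct.mk k M N)).compl₁₂
    δM δN)

@[simp] theorem tensorCoact_tmul (δM : M →ₗ[k] H ⊗[k] M) (δN : N →ₗ[k] H ⊗[k] N) (m : M) (n : N) :
    tensorCoact δM δN (m ⊗ₜ n) =
      TensorProduct.map₂ (LinearMap.mul k H) (TensorProduct.mk k M N) (δM m) (δN n) := rfl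

theorem isLeftCoaction_tensorCoact {δM : M →ₗ[k] H ⊗[k] M} {δN : N →ₗ[k] H ⊗[k] N}
    (hM : IsLeftCoaction δM) (hN : IsLeftCoaction δN) : IsLeftCoaction (tensorCoact δM δN) := by
  let Φ : H ⊗[k] (H ⊗[k] M) →ₗ[k] H ⊗[k] (H ⊗[k] N) →ₗ[k] H ⊗[k] (H ⊗[k] (M ⊗[k] N)) :=
    TensorProduct.map₂ (LinearMap.mul k H)
      (TensorProduct.map₂ (LinearMap.mul k H) (TensorProduct.mk k M N))
  have h1 (s : H ⊗[k] M) (t : H ⊗[k] N) : (tensorCoact δM δN).lTensor H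
      (TensorProduct.map₂ (LinearMap.mul k H) (TensorProduct.mk k M N) s t) =
      Φ (δM.lTensor H s) (δN.lTensor H t) := by
    induction s with
    | zero => simp
    | add s s' hs hs' => simp only [map_add, LinearMap.add_apply, hs, hs']
    | tmul c m =>
      induction t with
      | zero => simp
      | add t t' ht ht' => simp only [map_add, ht, ht']
      | tmul d n => simp [Φ]
  have h2 (s : H ⊗[k] M) (t : H ⊗[k] N) : TensorProduct.assoc k H H (M ⊗[k] N)
      ((Coalgebra.comul (R := k) (A := H)).rTensor _
        (TensorProduct.map₂ (LinearMap.mul k H) (TensorProduct.mk k M N) s t)) =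
      Φ (TensorProduct.assoc k H H M ((Coalgebra.comul (R := k) (A := H)).rTensor M s))
        (TensorProduct.assoc k H H N ((Coalgebra.comul (R := k) (A := H)).rTensor N t)) := by
    induction s with
    | zero => simp
    | add s s' hs hs' => simp only [map_add, LinearMap.add_apply, hs, hs']
    | tmul c m =>
      induction t with
      | zero => simp
      | add t t' ht ht' => simp only [map_add, ht, ht']
      | tmul d n =>
        simp only [TensorProduct.map₂_apply_tmul, TensorProduct.map_tmul, LinearMap.mul_apply',
          LinearMap.rTensor_tmul, Bialgebra.comul_mul, TensorProduct.mk_apply]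
        induction Coalgebra.comul (R := k) c with
        | zero => simp
        | add s s' hs hs' =>
          simp only [map_add, LinearMap.add_apply, add_mul, add_tmul, hs, hs']
        | tmul c c' =>
          induction Coalgebra.comul (R := k) d with
          | zero => simp
          | add s s' hs hs' => simp only [map_add, mul_add, add_tmul, hs, hs']
          | tmul d d' => simp [Φ]
  have h3 (s : H ⊗[k] M) (t : H ⊗[k] N) : (Coalgebra.counit (R := k) (A := H)).rTensor (M ⊗[k] N)
        (TensorProduct.map₂ (LinearMap.mul k H) (TensorProduct.mk k M N) s t) =
      TensorProduct.map₂ (LinearMap.mul k k) (TensorProduct.mk k M N)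
        ((Coalgebra.counit (R := k) (A := H)).rTensor M s)
        ((Coalgebra.counit (R := k) (A := H)).rTensor N t) := by
    induction s with
    | zero => simp
    | add s s' hs hs' => simp only [map_add, LinearMap.add_apply, hs, hs']
    | tmul c m =>
      induction t with
      | zero => simp
      | add t t' ht ht' => simp only [map_add, ht, ht']
      | tmul d n => simp
  constructor
  · intro x
    induction x with
    | zero => simp
    | add x y hx hy => simp only [map_add, hx, hy]
    | tmul m n => rw [tensorCoact_tmul, h1, h2, hM.coassoc, hN.coassoc]
  · intro x
    induction x with
    | zero => simp
    | add x y hx hy => simp only [map_add, tmul_add, hx, hy]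
    | tmul m n => rw [tensorCoact_tmul, h3, hM.counit, hN.counit]; simp

end TensorCoaction

/-! ### The generator A ⊗ H ⊗ A and its central coinvariants. -/

section Generator

variable {k H A : Type u} [Field k] [Ring H] [HopfAlgebra k H] [FiniteDimensional k H]
  [Ring A] [Algebra k A] [FiniteDimensional k A]

local notation "Δ" => Coalgebra.comul (R := k) (A := H)
local notation "ε" => Coalgebra.counit (R := k) (A := H)
local notation "𝑺" => HopfAlgebra.antipode k (A := H)

/-- The structure of a relative Hopf bimodule on `A ⊗ H ⊗ A`. -/
def generatorStr (δ : LeftComoduleAlgebra k H A) : HopfBimodStr δ (A ⊗[k] (H ⊗[k] A)) where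
  coact := tensorCoact δ.coact.toLinearMap (tensorCoact Δ δ.coact.toLinearMap)
  lact := LinearMap.rTensorHom (H ⊗[k] A) ∘ₗ LinearMap.mul k A
  ract := (LinearMap.lTensorHom A ∘ₗ LinearMap.lTensorHom H ∘ₗ (LinearMap.mul k A).flip).flip
  isLeftCoaction := isLeftCoaction_tensorCoact δ.isLeftCoaction
    (isLeftCoaction_tensorCoact isLeftCoaction_comul δ.isLeftCoaction)
  one_lact := by
    intro m
    induction m with
    | zero => simp
    | add s t hs ht => simp only [map_add, hs, ht]
    | tmul a u => simp
  mul_lact := by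
    intro a b m
    induction m with
    | zero => simp
    | add s t hs ht => simp only [map_add, hs, ht]
    | tmul a u => simp [mul_assoc]
  ract_one := by
    intro m
    induction m with
    | zero => simp
    | add s t hs ht => simp only [map_add, LinearMap.add_apply, hs, ht]
    | tmul a u =>
      have : LinearMap.mulRight k (1 : A) = LinearMap.id := by ext; simp
      change a ⊗ₜ (LinearMap.mulRight k (1 : A)).lTensor H u = a ⊗ₜ u
      rw [this, LinearMap.lTensor_id, LinearMap.id_apply]
  ract_mul := by
    intro m b c
    induction m with
    | zero => simp
    | add s t hs ht => simp only [map_add, LinearMap.add_apply, hs, ht]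
    | tmul a u =>
      have : LinearMap.mulRight k (b * c) = LinearMap.mulRight k c ∘ₗ LinearMap.mulRight k b := by
        ext; simp [mul_assoc]
      change a ⊗ₜ (LinearMap.mulRight k (b * c)).lTensor H u = a ⊗ₜ
        (LinearMap.mulRight k c).lTensor H ((LinearMap.mulRight k b).lTensor H u)
      rw [this, LinearMap.lTensor_comp, LinearMap.comp_apply]
  lact_ract := by
    intro a m b
    induction m with
    | zero => simp
    | add s t hs ht => simp only [map_add, LinearMap.add_apply, hs, ht]
    | tmul c u => rfl
  coact_lact := by
    intro a m
    induction m with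
    | zero => simp
    | add s t hs ht => simp only [map_add, hs, ht]
    | tmul c u =>
      change tensorCoact _ _ ((a * c) ⊗ₜ u) = _
      rw [tensorCoact_tmul, tensorCoact_tmul, AlgHom.toLinearMap_apply, map_mul,
        AlgHom.toLinearMap_apply]
      induction δ.coact a with
      | zero => simp
      | add s t hs ht => simp only [map_add, LinearMap.add_apply, add_mul, hs, ht]
      | tmul d a =>
        induction δ.coact c with
        | zero => simp
        | add s t hs ht => simp only [map_add, LinearMap.add_apply, mul_add, hs, ht]
        | tmul e c =>
          induction tensorCoact Δ δ.coact.toLinearMap u with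
          | zero => simp
          | add s t hs ht => simp only [map_add, hs, ht]
          | tmul f u => simp [mul_assoc]
  coact_ract := by
    intro m b
    induction m with
    | zero => simp
    | add s t hs ht => simp only [map_add, LinearMap.add_apply, hs, ht]
    | tmul a u =>
      induction u with
      | zero => simp
      | add s t hs ht => simp only [tmul_add, map_add, LinearMap.add_apply, hs, ht]
      | tmul h c =>
        change tensorCoact _ _ (a ⊗ₜ (h ⊗ₜ (c * b))) = _
        simp only [tensorCoact_tmul, AlgHom.toLinearMap_apply, map_mul]
        induction δ.coact a with
        | zero => simp
        | add s t hs ht => simp only [map_add, LinearMap.add_apply, hs, ht]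
        | tmul d a =>
          induction Δ h with
          | zero => simp
          | add s t hs ht => simp only [map_add, LinearMap.add_apply, hs, ht]
          | tmul e e' =>
            induction δ.coact c with
            | zero => simp
            | add s t hs ht => simp only [map_add, LinearMap.add_apply, add_mul, hs, ht]
            | tmul f c =>
              induction δ.coact b with
              | zero => simp
              | add s t hs ht => simp only [map_add, mul_add, hs, ht]
              | tmul f b => simp [mul_assoc]

/-- The relative Hopf bimodule `A ⊗ H ⊗ A`, freely generated by the regular comodule `H`. -/
def generator (δ : LeftComoduleAlgebra k H A) : HopfBimod δ where
  carrier := A ⊗[k] (H ⊗[k] A)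
  str := generatorStr δ

/-- The pure tensors in the generator. -/
def generatorMk (δ : LeftComoduleAlgebra k H A) (a : A) (u : H ⊗[k] A) : generator δ :=
  (a ⊗ₜ[k] u : A ⊗[k] (H ⊗[k] A))

variable {δ : LeftComoduleAlgebra k H A} {lamH : H →ₗ[k] k} {L : H}

/-- A left integral freely generates the comodule `H`. -/
theorem exists_comodule_map (hlamH : IsRightCointegral lamH) (hlamH0 : lamH ≠ 0)
    (hL : IsLeftIntegral (k := k) L) (hL0 : L ≠ 0) {M : Type u} [AddCommGroup M] [Module k M]
    {δM : M →ₗ[k] H ⊗[k] M} (hM : IsLeftCoaction δM) (x : M) :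
    ∃ Ψ : H →ₗ[k] M, Ψ L = x ∧ ∀ h, δM (Ψ h) = Ψ.lTensor H (Δ h) := by
  have hLL := cointegral_integral_ne_zero hlamH hlamH0 hL hL0
  -- Ψ is to send Λ ↼ f to x ↼ f. This is well defined because f ↦ Λ ↼ f is bijective: for f = λ(u
  -- -), `coactConv_integral` recovers u from S(Λ ↼ f) = λ(Λ) u.
  let E₀ : Module.Dual k H →ₗ[k] H :=
    { toFun := fun f => hitRight Δ f L
      map_add' := fun f f' => hitRight_add _ f f' L
      map_smul' := fun c f => hitRight_smul _ c f L }
  let R : Module.Dual k H →ₗ[k] M :=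
    { toFun := fun f => hitRight δM f x
      map_add' := fun f f' => hitRight_add _ f f' x
      map_smul' := fun c f => hitRight_smul _ c f x }
  have hE : Function.Injective E₀ := by
    rw [← LinearMap.ker_eq_bot, LinearMap.ker_eq_bot']
    intro f hf
    obtain ⟨u, hu⟩ := hlamH.exists_eq hlamH0 f
    have h1 := coactConv_integral hlamH hL u
    rw [coactConv_linearMap_antipode] at h1
    have h2 : lamH ∘ₗ LinearMap.mulLeft k u = f := by
      ext z
      simp [hu]
    have h3 : hitRight Δ f L = 0 := hf
    rw [h2, h3, map_zero] at h1
    have hu0 : u = 0 := (smul_eq_zero.1 h1.symm).resolve_left hLL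
    ext z
    simp [hu, hu0]
  let E : Module.Dual k H ≃ₗ[k] H := LinearEquiv.ofBijective E₀ ⟨hE,
    (LinearMap.injective_iff_surjective_of_finrank_eq_finrank
      (Subspace.dual_finrank_eq (K := k) (V := H))).1 hE⟩
  have hER (f : Module.Dual k H) :
      (R ∘ₗ E.symm.toLinearMap) (hitRight Δ f L) = hitRight δM f x :=
    congrArg R (E.symm_apply_apply f)
  refine ⟨R ∘ₗ E.symm.toLinearMap, ?_, fun h => ext_of_rTensor fun φ => ?_⟩
  · have := hER Coalgebra.counit
    rwa [hitRight_counit hM, hitRight_counit isLeftCoaction_comul] at this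
  · obtain ⟨f, rfl⟩ := E.surjective h
    have h1 (s : H ⊗[k] H) : TensorProduct.lid k M (φ.rTensor M
        ((R ∘ₗ E.symm.toLinearMap).lTensor H s)) =
        (R ∘ₗ E.symm.toLinearMap) (TensorProduct.lid k H (φ.rTensor H s)) := by
      induction s with
      | zero => simp
      | add s t hs ht => simp only [map_add, hs, ht]
      | tmul c d => simp
    rw [h1, ← hitRight_apply, ← hitRight_apply]
    change hitRight δM φ ((R ∘ₗ E.symm.toLinearMap) (hitRight Δ f L)) =
      (R ∘ₗ E.symm.toLinearMap) (hitRight Δ φ (hitRight Δ f L))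
    rw [hER, hitRight_hitRight hM, hitRight_hitRight isLeftCoaction_comul, hER]

/-- The element `1 ⊗ Λ ⊗ 1` of the generator. -/
def generatorElt (δ : LeftComoduleAlgebra k H A) (L : H) : generator δ :=
  generatorMk δ 1 (L ⊗ₜ[k] (1 : A))

/-- The bimodule `A ⊗ H ⊗ A` is a generator. -/
theorem exists_hom_generator (hlamH : IsRightCointegral lamH) (hlamH0 : lamH ≠ 0)
    (hL : IsLeftIntegral (k := k) L) (hL0 : L ≠ 0) (X : HopfBimod δ) (x : X) :
    ∃ q : generator δ ⟶ X, HopfBimod.toLin q (generatorElt δ L) = x := by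
  obtain ⟨Ψ, hΨ, hΨ'⟩ := exists_comodule_map hlamH hlamH0 hL hL0 X.str.isLeftCoaction x
  let R : H ⊗[k] A →ₗ[k] X := TensorProduct.lift (X.str.ract ∘ₗ Ψ)
  let q : A ⊗[k] (H ⊗[k] A) →ₗ[k] X := TensorProduct.lift (X.str.lact.compl₂ R)
  have hq (a : A) (h : H) (b : A) : q (a ⊗ₜ (h ⊗ₜ b)) = X.str.lact a (X.str.ract (Ψ h) b) := rfl
  have hR (s : H ⊗[k] H) (t : H ⊗[k] A) :
      TensorProduct.map₂ (LinearMap.mul k H) X.str.ract (Ψ.lTensor H s) t =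
      R.lTensor H (TensorProduct.map₂ (LinearMap.mul k H) (TensorProduct.mk k H A) s t) := by
    induction s with
    | zero => simp
    | add s s' hs hs' => simp only [map_add, LinearMap.add_apply, hs, hs']
    | tmul c m =>
      induction t with
      | zero => simp
      | add t t' ht ht' => simp only [map_add, ht, ht']
      | tmul d n => simp [R]
  have hqR (s : H ⊗[k] A) (t : H ⊗[k] (H ⊗[k] A)) :
      TensorProduct.map₂ (LinearMap.mul k H) X.str.lact s (R.lTensor H t) =
      q.lTensor H (TensorProduct.map₂ (LinearMap.mul k H) (TensorProduct.mk k A _) s t) := by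
    induction s with
    | zero => simp
    | add s s' hs hs' => simp only [map_add, LinearMap.add_apply, hs, hs']
    | tmul c m =>
      induction t with
      | zero => simp
      | add t t' ht ht' => simp only [map_add, ht, ht']
      | tmul d n => simp [q]
  have h1 (a : A) (y : A ⊗[k] (H ⊗[k] A)) :
      q ((generatorStr δ).lact a y) = X.str.lact a (q y) := by
    induction y with
    | zero => simp
    | add s t hs ht => simp only [map_add, hs, ht]
    | tmul b u => exact X.str.mul_lact a b _
  have h2 (y : A ⊗[k] (H ⊗[k] A)) (b : A) :
      q ((generatorStr δ).ract y b) = X.str.ract (q y) b := by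
    induction y with
    | zero => simp
    | add s t hs ht => simp only [map_add, LinearMap.add_apply, hs, ht]
    | tmul a u =>
      induction u with
      | zero => simp
      | add s t hs ht => simp only [tmul_add, map_add, LinearMap.add_apply, hs, ht]
      | tmul h c =>
        change q (a ⊗ₜ (h ⊗ₜ (c * b))) = _
        rw [hq, hq, X.str.ract_mul, X.str.lact_ract]
  have h3 (y : A ⊗[k] (H ⊗[k] A)) :
      X.str.coact (q y) = q.lTensor H ((generatorStr δ).coact y) := by
    induction y with
    | zero => simp
    | add s t hs ht => simp only [map_add, hs, ht]
    | tmul a u =>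
      induction u with
      | zero => simp
      | add s t hs ht => simp only [tmul_add, map_add, hs, ht]
      | tmul h c =>
        rw [hq, X.str.coact_lact, X.str.coact_ract, hΨ', hR, hqR]
        rfl
  refine ⟨⟨q, h1, h2, h3⟩, ?_⟩
  change q (1 ⊗ₜ (L ⊗ₜ 1)) = x
  rw [hq, X.str.one_lact, X.str.ract_one, hΨ]

section

variable (δ)

/-- The map `h ⊗ b ↦ h b₍₋₁₎ ⊗ b₍₀₎`. -/
def untwist : H ⊗[k] A →ₗ[k] H ⊗[k] A :=
  LinearMap.mul' k (H ⊗[k] A) ∘ₗ TensorProduct.map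
    (Algebra.TensorProduct.includeLeft (R := k) (S := k) (A := H) (B := A)).toLinearMap
    δ.coact.toLinearMap

omit [FiniteDimensional k H] [FiniteDimensional k A] in
@[simp] theorem untwist_tmul (h : H) (b : A) : untwist δ (h ⊗ₜ b) = (h ⊗ₜ 1) * δ.coact b := rfl

-- The inverse is h ⊗ b ↦ h S(b₍₋₁₎) ⊗ b₍₀₎.
omit [FiniteDimensional k H] [FiniteDimensional k A] in
theorem untwist_injective : Function.Injective (untwist δ) := by
  let ι : H →ₐ[k] H ⊗[k] A := Algebra.TensorProduct.includeLeft
  let ρ : A →ₗ[k] H ⊗[k] A :=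
    (Algebra.TensorProduct.includeRight (R := k) (A := H) (B := A)).toLinearMap
  let Y : H ⊗[k] A →ₗ[k] H ⊗[k] A := LinearMap.mul' k (H ⊗[k] A) ∘ₗ TensorProduct.map ι.toLinearMap
    (coactConv δ.coact.toLinearMap (ι.toLinearMap ∘ₗ 𝑺) ρ)
  have hY (c : H) (t : H ⊗[k] A) : Y ((c ⊗ₜ 1) * t) = (c ⊗ₜ 1) * Y t := by
    induction t with
    | zero => simp
    | add s t hs ht => simp only [map_add, mul_add, hs, ht]
    | tmul d a =>
      rw [Algebra.TensorProduct.tmul_mul_tmul, one_mul]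
      change ι (c * d) * _ = ι c * (ι d * _)
      rw [map_mul, mul_assoc]
  have hY' (b : A) : Y (δ.coact b) = 1 ⊗ₜ b := by
    have h1 : coactConv δ.coact.toLinearMap ι.toLinearMap
        (coactConv δ.coact.toLinearMap (ι.toLinearMap ∘ₗ 𝑺) ρ) = ρ := by
      rw [coactConv_coactConv δ.isLeftCoaction, coactConv_antipode,
        counit_coactConv δ.isLeftCoaction]
    exact LinearMap.congr_fun h1 b
  refine Function.LeftInverse.injective (g := Y) fun s => ?_
  induction s with
  | zero => simp
  | add s t hs ht => simp only [map_add, hs, ht]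
  | tmul c a => simp [hY, hY']

omit [FiniteDimensional k H] [FiniteDimensional k A] in
theorem lTensor_counit_tensorCoact (s : H ⊗[k] A) :
    ((TensorProduct.lid k A).toLinearMap ∘ₗ (ε).rTensor A).lTensor H
      (tensorCoact Δ δ.coact.toLinearMap s) = untwist δ s := by
  induction s with
  | zero => simp
  | add s t hs ht => simp only [map_add, hs, ht]
  | tmul c a =>
    have h1 (s : H ⊗[k] H) (t : H ⊗[k] A) :
        ((TensorProduct.lid k A).toLinearMap ∘ₗ (ε).rTensor A).lTensor H
          (TensorProduct.map₂ (LinearMap.mul k H) (TensorProduct.mk k H A) s t) =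
        (TensorProduct.rid k H ((ε).lTensor H s) ⊗ₜ 1) * t := by
      induction s with
      | zero => simp
      | add s s' hs hs' => simp only [map_add, LinearMap.add_apply, add_tmul, add_mul, hs, hs']
      | tmul c m =>
        induction t with
        | zero => simp
        | add t t' ht ht' => simp only [map_add, mul_add, ht, ht']
        | tmul d n => simp [← smul_tmul']
    rw [tensorCoact_tmul, h1, Coalgebra.lTensor_counit_comul]
    simp

end

variable {lamA : A →ₗ[k] k} {gA : GroupLike k H}

/-- The map `a ⊗ h ⊗ b ↦ λ(a) ε(h) b`. -/
def generatorTrace (lamA : A →ₗ[k] k) :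
    A ⊗[k] (H ⊗[k] A) →ₗ[k] A :=
  ((TensorProduct.lid k A).toLinearMap ∘ₗ (ε).rTensor A) ∘ₗ
    (TensorProduct.lid k (H ⊗[k] A)).toLinearMap ∘ₗ lamA.rTensor (H ⊗[k] A)

-- With q = λ_A ⊗ id ⊗ id, centrality gives (λ_A(a -) ⊗ id)(m) = q(m) a, so q(m) determines m.
-- Coinvariance gives 1 ⊗ q(m) = g_A q(m)₍₋₁₎ ⊗ q(m)₍₀₎; applying ε to the inner H-leg makes the
-- left side 1 ⊗ (trace of m) and the right side g_A times `untwist` of q(m), so the trace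
-- determines q(m).
omit [FiniteDimensional k H] [FiniteDimensional k A] in
theorem generatorTrace_eq_zero (hlam : IsGCointegral δ gA lamA) (h : IsFrobeniusTrace lamA)
    (m : A ⊗[k] (H ⊗[k] A))
    (hm : ∀ a : A, (generatorStr δ).lact a m = (generatorStr δ).ract m a)
    (hm' : (generatorStr δ).coact m = 1 ⊗ₜ m) (hm0 : generatorTrace (H := H) lamA m = 0) : m = 0 := by
  let q : A ⊗[k] (H ⊗[k] A) →ₗ[k] H ⊗[k] A :=
    (TensorProduct.lid k (H ⊗[k] A)).toLinearMap ∘ₗ lamA.rTensor (H ⊗[k] A)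
  have hq0 : q m = 0 → m = 0 := by
    intro hqm
    refine ext_of_rTensor fun φ => ?_
    obtain ⟨a, rfl⟩ := h.2 φ
    have h1 (y : A ⊗[k] (H ⊗[k] A)) : TensorProduct.lid k (H ⊗[k] A)
        ((lamA ∘ₗ LinearMap.mulLeft k a).rTensor (H ⊗[k] A) y) =
        q ((generatorStr δ).lact a y) := by
      induction y with
      | zero => simp
      | add s t hs ht => simp only [map_add, hs, ht]
      | tmul b u => rfl
    have h2 (y : A ⊗[k] (H ⊗[k] A)) : q ((generatorStr δ).ract y a) =
        (LinearMap.mulRight k a).lTensor H (q y) := by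
      induction y with
      | zero => simp
      | add s t hs ht => simp only [map_add, LinearMap.add_apply, hs, ht]
      | tmul b u => exact (map_smul ((LinearMap.mulRight k a).lTensor H) (lamA b) u).symm
    rw [h1, hm, h2, hqm]
    simp
  have hq1 (y : A ⊗[k] (H ⊗[k] A)) : q.lTensor H ((generatorStr δ).coact y) =
      (LinearMap.mulLeft k (gA : H)).rTensor _ (tensorCoact Δ δ.coact.toLinearMap (q y)) := by
    induction y with
    | zero => simp
    | add s t hs ht => simp only [map_add, hs, ht]
    | tmul a u =>
      have h1 (s : H ⊗[k] A) (t : H ⊗[k] (H ⊗[k] A)) :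
          q.lTensor H (TensorProduct.map₂ (LinearMap.mul k H) (TensorProduct.mk k A _) s t) =
          (LinearMap.mulLeft k (TensorProduct.rid k H (lamA.lTensor H s))).rTensor _ t := by
        induction t with
        | zero => simp
        | add t t' ht ht' => simp only [map_add, ht, ht']
        | tmul d n =>
          induction s with
          | zero => simp
          | add s s' hs hs' =>
            simp only [map_add, LinearMap.add_apply, hs, hs', LinearMap.rTensor_tmul,
              LinearMap.mulLeft_apply, add_mul, add_tmul]
          | tmul c m => simp [q, smul_tmul]
      refine (h1 _ _).trans ?_
      rw [AlgHom.toLinearMap_apply, hlam]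
      have h2 : LinearMap.mulLeft k (lamA a • (gA : H)) = lamA a • LinearMap.mulLeft k (gA : H) := by
        ext; simp
      have h3 : q (a ⊗ₜ u) = lamA a • u := by simp [q]
      rw [h2, h3, LinearMap.rTensor_smul, LinearMap.smul_apply, map_smul, map_smul]
  have hq2 : (LinearMap.mulLeft k (gA : H)).rTensor A (untwist δ (q m)) = 0 := by
    have h1 : ((TensorProduct.lid k A).toLinearMap ∘ₗ (ε).rTensor A).lTensor H
        (q.lTensor H ((generatorStr δ).coact m)) = 0 := by
      rw [hm']
      change (1 : H) ⊗ₜ[k] generatorTrace (H := H) lamA m = 0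
      rw [hm0, tmul_zero]
    rw [hq1] at h1
    rw [← lTensor_counit_tensorCoact, ← h1, ← LinearMap.comp_apply (LinearMap.rTensor A _),
      LinearMap.rTensor_comp_lTensor, ← LinearMap.comp_apply (LinearMap.lTensor H _),
      LinearMap.lTensor_comp_rTensor]
  have hq3 : untwist δ (q m) = 0 := by
    have h1 := congrArg ((LinearMap.mulLeft k ((gA⁻¹ : GroupLike k H) : H)).rTensor A) hq2
    have h2 : LinearMap.mulLeft k ((gA⁻¹ : GroupLike k H) : H) ∘ₗ LinearMap.mulLeft k (gA : H) =
        LinearMap.id := by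
      rw [← LinearMap.mulLeft_mul, val_inv_mul_val, LinearMap.mulLeft_one]
    rwa [← LinearMap.comp_apply, ← LinearMap.rTensor_comp, h2, LinearMap.rTensor_id, map_zero]
      at h1
  exact hq0 (untwist_injective δ (hq3.trans (map_zero _).symm))

/-- The Casimir sum disappears because ∑ λ_A(eᵢ) eⁱ = 1. What remains is λ_H(g_A Λ b₍₋₁₎) b₍₀₎, and
g_A Λ c = α(c) Λ. -/
theorem generatorTrace_average {α : H →ₐ[k] k} (hL : IsLeftIntegral (k := k) L)
    (hα : IsLeftModularFunction L α) (h : IsFrobeniusTrace lamA) (b : A) :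
    generatorTrace (H := H) lamA (average lamH gA h (generator δ)
      ((generator δ).str.ract (generatorElt δ L) b)) =
      lamH L • hitRight δ.coact.toLinearMap α.toLinearMap b := by
  let e : H ⊗[k] A →ₗ[k] A := (TensorProduct.lid k A).toLinearMap ∘ₗ (ε).rTensor A
  let f := twistedCointegral lamH gA
  have h0 : (generator δ).str.ract (generatorElt δ L) b =
      generatorMk δ 1 (L ⊗ₜ[k] b) := by
    change (1 : A) ⊗ₜ[k] (L ⊗ₜ[k] (1 * b)) = (1 : A) ⊗ₜ[k] (L ⊗ₜ[k] b)
    rw [one_mul]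
  have h1 (u : H ⊗[k] A) : generatorTrace (H := H) lamA (casimir h (generator δ) (generatorMk δ 1 u)) = e u := by
    have h2 (i) : generatorTrace (H := H) lamA ((generator δ).str.lact (Module.finBasis k A i)
        ((generator δ).str.ract (generatorMk δ 1 u) (h.dualBasis i))) =
        e u * (lamA (1 * Module.finBasis k A i) • h.dualBasis i) := by
      change e (lamA (Module.finBasis k A i * 1) •
        (LinearMap.mulRight k (h.dualBasis i)).lTensor H u) = _
      rw [map_smul, mul_one, one_mul, mul_smul_comm]
      congr 1
      induction u with
      | zero => simp
      | add s t hs ht => simp only [map_add, add_mul, hs, ht]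
      | tmul c a => simp [e]
    rw [casimir_apply]
    refine (map_sum (generatorTrace (H := H) lamA) _ _).trans ?_
    simp_rw [h2]
    rw [← Finset.mul_sum, h.sum_basis_smul_dualBasis, mul_one]
  have h2 : hitRight (generator δ).str.coact f (generatorMk δ 1 (L ⊗ₜ[k] b)) =
      generatorMk δ 1 (hitRight (tensorCoact Δ δ.coact.toLinearMap) f (L ⊗ₜ b)) := by
    rw [hitRight_apply, hitRight_apply]
    change TensorProduct.lid k (A ⊗[k] (H ⊗[k] A)) (f.rTensor _ (TensorProduct.map₂
      (LinearMap.mul k H) (TensorProduct.mk k A _) (δ.coact 1) _)) =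
      (1 : A) ⊗ₜ[k] (TensorProduct.lid k _ (f.rTensor _ _))
    rw [map_one, Algebra.TensorProduct.one_def]
    induction tensorCoact Δ δ.coact.toLinearMap (L ⊗ₜ b) with
    | zero => simp
    | add s t hs ht => simp only [map_add, tmul_add, hs, ht]
    | tmul c a => simp
  have h3 (s : H ⊗[k] (H ⊗[k] A)) : e (TensorProduct.lid k _ (f.rTensor _ s)) =
      TensorProduct.lid k A (f.rTensor A (e.lTensor H s)) := by
    induction s with
    | zero => simp
    | add s t hs ht => simp only [map_add, hs, ht]
    | tmul c a => simp
  have hf (c : H) : f (L * c) = lamH L * α c := by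
    change lamH (gA * (L * c)) = _
    rw [← mul_assoc, hL, counit_groupLike, one_smul, hα, map_smul, smul_eq_mul, mul_comm]
  rw [h0, average_apply, h2, h1]
  rw [hitRight_apply, h3, lTensor_counit_tensorCoact, untwist_tmul, hitRight_apply,
    AlgHom.toLinearMap_apply]
  induction δ.coact b with
  | zero => simp
  | add s t hs ht => simp only [map_add, mul_add, smul_add, hs, ht]
  | tmul c a => simp [hf, smul_smul]

/-- The trace κ is injective on Hom(A, P), and its composite with the map in question is λ_H(Λ)
times the bijection b ↦ b ↼ α; hence both maps are bijective. -/
theorem averageHom_generator_bijective (hlamH : IsRightCointegral lamH) (hlamH0 : lamH ≠ 0)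
    (hL : IsLeftIntegral (k := k) L) (hL0 : L ≠ 0) {α : H →ₐ[k] k}
    (hα : IsLeftModularFunction L α) (hlam : IsGCointegral δ gA lamA) (h : IsFrobeniusTrace lamA) :
    Function.Bijective fun b : A => averageHom hlamH hlam h (generator δ)
      ((generator δ).str.ract (generatorElt δ L) b) := by
  have hLL := cointegral_integral_ne_zero hlamH hlamH0 hL hL0
  let κ : (unitObj δ ⟶ generator δ) → A := fun f =>
    generatorTrace (H := H) lamA (HopfBimod.toLin f (1 : A))
  have hκ : Function.Injective κ := by
    intro f f' hff'
    rw [← sub_eq_zero]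
    refine unit_hom_ext ?_
    refine (generatorTrace_eq_zero hlam h _ (toLin_unit_central (X := generator δ) (f - f'))
      (toLin_unit_coinvariant (X := generator δ) (f - f')) ?_).trans rfl
    exact (map_sub (generatorTrace (H := H) lamA) _ _).trans (sub_eq_zero.2 hff')
  have hκ' (b : A) : κ (averageHom hlamH hlam h (generator δ)
      ((generator δ).str.ract (generatorElt δ L) b)) =
      lamH L • hitRight δ.coact.toLinearMap α.toLinearMap b :=
    (congrArg (generatorTrace (H := H) lamA) (toLin_averageHom hlamH hlam h _ _)).trans
      (generatorTrace_average hL hα h b)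
  have hsurj : Function.Surjective (hitRight δ.coact.toLinearMap α.toLinearMap) := fun a =>
    ⟨_, hitRight_antipode_hitRight δ.isLeftCoaction α a⟩
  have hinj := LinearMap.injective_iff_surjective.2 hsurj
  constructor
  · intro b b' hbb'
    have h1 := congrArg κ hbb'
    dsimp only at h1
    rw [hκ', hκ'] at h1
    exact hinj (smul_right_injective A hLL h1)
  · intro f
    obtain ⟨b, hb⟩ := hsurj ((lamH L)⁻¹ • κ f)
    refine ⟨b, hκ ((hκ' b).trans ?_)⟩
    rw [hb, smul_smul, mul_inv_cancel₀ hLL, one_smul]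

end Generator

end

noncomputable section

/-! ### Recognizing the coend by means of a generator. -/

section Coend

variable {k H A : Type u} [Field k] [Ring H] [HopfAlgebra k H] [Ring A] [Algebra k A]
  {δ : LeftComoduleAlgebra k H A}

namespace HopfBimod

/-- A family of linear maps `Hom(M, X)^* → Hom(X, Z)` is natural. -/
def IsNaturalFamily {M Z : HopfBimod δ}
    (ψ : ∀ X : HopfBimod δ, Module.Dual k (M ⟶ X) →ₗ[k] (X ⟶ Z)) : Prop :=
  ∀ (X Y : HopfBimod δ) (f : X ⟶ Y) (ξ : Module.Dual k (M ⟶ Y)),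
    ψ X ((postcomp M f).dualMap ξ) = f ≫ ψ Y ξ

variable {M N : HopfBimod δ} {π : ∀ X : HopfBimod δ, Module.Dual k (M ⟶ X) →ₗ[k] (X ⟶ N)}
  {P : HopfBimod δ} {p : P}

/-- Evaluation at p forces u(π_P(ξ)(p)) = ψ_P(ξ)(p), which defines u by `hθ`. For x = q(p) in any X,
naturality along q reduces the required identity to the one at P. Each element of N is some
π_P(ξ)(p), so u inherits linearity and colinearity from π_P(ξ) and ψ_P(ξ). -/
theorem IsNaturalFamily.existsUnique_hom (hπ : IsNaturalFamily π)
    (hP : ∀ (X : HopfBimod δ) (x : X), ∃ q : P ⟶ X, toLin q p = x)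
    (hθ : Function.Bijective fun ξ : Module.Dual k (M ⟶ P) => toLin (π P ξ) p)
    {Z : HopfBimod δ} {ψ : ∀ X : HopfBimod δ, Module.Dual k (M ⟶ X) →ₗ[k] (X ⟶ Z)}
    (hψ : IsNaturalFamily ψ) :
    ∃! u : N ⟶ Z, ∀ (X : HopfBimod δ) (ξ : Module.Dual k (M ⟶ X)), π X ξ ≫ u = ψ X ξ := by
  let θ : Module.Dual k (M ⟶ P) ≃ₗ[k] N := LinearEquiv.ofBijective
    { toFun := fun ξ => toLin (π P ξ) p
      map_add' := fun ξ ξ' => by simp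
      map_smul' := fun c ξ => by simp } hθ
  let u : N →ₗ[k] Z :=
    { toFun := fun y => toLin (ψ P (θ.symm y)) p
      map_add' := fun y y' => by simp
      map_smul' := fun c y => by simp }
  have hu (X : HopfBimod δ) (ξ : Module.Dual k (M ⟶ X)) (x : X) :
      u (toLin (π X ξ) x) = toLin (ψ X ξ) x := by
    obtain ⟨q, rfl⟩ := hP X x
    have h1 : toLin (π X ξ) (toLin q p) = θ ((postcomp M q).dualMap ξ) :=
      (congrArg (fun f => toLin f p) (hπ P X q ξ)).symm
    have h2 : toLin (ψ X ξ) (toLin q p) = toLin (ψ P ((postcomp M q).dualMap ξ)) p :=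
      (congrArg (fun f => toLin f p) (hψ P X q ξ)).symm
    rw [h1, h2]
    exact congrArg (fun η => toLin (ψ P η) p) (θ.symm_apply_apply _)
  have hsurj (y : N) : ∃ ξ : Module.Dual k (M ⟶ P), toLin (π P ξ) p = y := hθ.2 y
  have humem : u ∈ homs N Z := by
    refine ⟨fun a y => ?_, fun y a => ?_, fun y => ?_⟩ <;> obtain ⟨ξ, rfl⟩ := hsurj y
    · rw [hu]
      refine (congrArg u ((π P ξ).2.1 a p).symm).trans ?_
      exact (hu _ _ _).trans ((ψ P ξ).2.1 a p)
    · rw [hu]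
      refine (congrArg u ((π P ξ).2.2.1 p a).symm).trans ?_
      exact (hu _ _ _).trans ((ψ P ξ).2.2.1 p a)
    · rw [hu]
      refine ((ψ P ξ).2.2.2 p).trans ?_
      have h1 : (ψ P ξ).1 = u ∘ₗ (π P ξ).1 := LinearMap.ext fun x => (hu P ξ x).symm
      rw [h1, LinearMap.lTensor_comp]
      exact congrArg (u.lTensor H) ((π P ξ).2.2.2 p).symm
  refine ⟨⟨u, humem⟩, fun X ξ => hom_ext (LinearMap.ext fun x => hu X ξ x), fun v hv => ?_⟩
  refine hom_ext (LinearMap.ext fun y => ?_)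
  obtain ⟨ξ, rfl⟩ := hsurj y
  exact (congrArg (fun f => toLin f p) (hv P ξ)).trans (hu P ξ p).symm

theorem copowerMk_copowerHomEquiv_symm {V : Type u} [AddCommGroup V] [Module k V]
    [Module.Finite k V] {X Y : HopfBimod δ} (φ : V →ₗ[k] (X ⟶ Y)) (v : V) :
    copowerMk X v ≫ (copowerHomEquiv V X Y).symm φ = φ v :=
  LinearMap.congr_fun ((copowerHomEquiv V X Y).apply_symm_apply φ) v

theorem copower_hom_ext {V : Type u} [AddCommGroup V] [Module k V]
    [Module.Finite k V] {X Y : HopfBimod δ} {F G : copower V X ⟶ Y}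
    (h : ∀ v, copowerMk X v ≫ F = copowerMk X v ≫ G) : F = G :=
  (copowerHomEquiv V X Y).injective (LinearMap.ext h)

theorem copowerMk_copowerMap {V W : Type u} [AddCommGroup V] [Module k V]
    [Module.Finite k V] [AddCommGroup W] [Module k W] [Module.Finite k W] {X Y : HopfBimod δ}
    (φ : V →ₗ[k] W) (f : X ⟶ Y) (v : V) :
    copowerMk X v ≫ copowerMap φ f = f ≫ copowerMk Y (φ v) := rfl

/-- A natural family `Hom(M, X)^* → Hom(X, N)` exhibits `N` as the value of the Nakayama functor
at `M` if it induces a bijection `Hom(M, P)^* → N` for a generator `P`. -/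
theorem IsNaturalFamily.isNakayama (hπ : IsNaturalFamily π)
    (hP : ∀ (X : HopfBimod δ) (x : X), ∃ q : P ⟶ X, toLin q p = x)
    (hθ : Function.Bijective fun ξ : Module.Dual k (M ⟶ P) => toLin (π P ξ) p) :
    IsNakayama M N := by
  let ι (X : HopfBimod δ) : copower (Module.Dual k (M ⟶ X)) X ⟶ N :=
    (copowerHomEquiv _ X N).symm (π X)
  have hι (X : HopfBimod δ) (ξ : Module.Dual k (M ⟶ X)) : copowerMk X ξ ≫ ι X = π X ξ :=
    copowerMk_copowerHomEquiv_symm _ _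
  let W : Limits.Cowedge (nakayamaDiagram M) := Limits.Cowedge.mk N ι (by
    intro X Y f
    refine copower_hom_ext fun ξ => ?_
    change copowerMk X ξ ≫ copowerMap (postcomp M f).dualMap (𝟙 X) ≫ ι X =
      copowerMk X ξ ≫ copowerMap LinearMap.id f ≫ ι Y
    rw [← Category.assoc, ← Category.assoc, copowerMk_copowerMap, copowerMk_copowerMap,
      Category.id_comp, Category.assoc, hι, hπ]
    exact congrArg (f ≫ ·) (hι Y ξ).symm)
  let ψ (E : Limits.Cowedge (nakayamaDiagram M)) (X : HopfBimod δ) :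
      Module.Dual k (M ⟶ X) →ₗ[k] (X ⟶ E.pt) := copowerHomEquiv _ X E.pt (E.π X)
  have hψ (E : Limits.Cowedge (nakayamaDiagram M)) : IsNaturalFamily (ψ E) := by
    intro X Y f ξ
    exact congrArg (fun F : copower (Module.Dual k (M ⟶ Y)) X ⟶ E.pt => copowerMk X ξ ≫ F)
      (Limits.Cowedge.condition E f)
  choose u hu hu' using fun E => (hπ.existsUnique_hom hP hθ (hψ E)).exists.elim
    fun v hv => (⟨v, hv, fun w hw => (hπ.existsUnique_hom hP hθ (hψ E)).unique hw hv⟩ :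
      ∃ v : N ⟶ E.pt, (∀ X ξ, π X ξ ≫ v = ψ E X ξ) ∧
        ∀ w : N ⟶ E.pt, (∀ X ξ, π X ξ ≫ w = ψ E X ξ) → w = v)
  have fac (E : Limits.Cowedge (nakayamaDiagram M)) (X : HopfBimod δ) :
      ι X ≫ u E = (E.π X : copower (Module.Dual k (M ⟶ X)) X ⟶ E.pt) := by
    refine copower_hom_ext fun ξ => Eq.trans ?_ (hu E X ξ)
    rw [← Category.assoc, hι]
  have uniq (E : Limits.Cowedge (nakayamaDiagram M)) (v : N ⟶ E.pt)
      (hv : ∀ X : HopfBimod δ,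
        ι X ≫ v = (E.π X : copower (Module.Dual k (M ⟶ X)) X ⟶ E.pt)) : v = u E := by
    refine hu' E v fun X ξ => ?_
    rw [← hι X ξ, Category.assoc, hv]
    rfl
  have hW : Limits.IsColimit W := Limits.Multicofork.IsColimit.mk W u fac uniq
  have hcoend : Limits.HasCoend (nakayamaDiagram M) := ⟨⟨⟨W, hW⟩⟩⟩
  exact ⟨hcoend, ⟨hW.coconePointUniqueUpToIso (Limits.colimit.isColimit _)⟩⟩

end HopfBimod

/-- Transport of the laws of a relative Hopf bimodule along a jointly surjective family of maps
that are compatible with the structure maps. -/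
def HopfBimodStr.ofSurjective {P N : Type u} [AddCommGroup P] [Module k P] [AddCommGroup N]
    [Module k N] (s : HopfBimodStr δ P) (coact : N →ₗ[k] H ⊗[k] N) (lact : A →ₗ[k] N →ₗ[k] N)
    (ract : N →ₗ[k] A →ₗ[k] N)
    (h : ∀ y : N, ∃ (f : P →ₗ[k] N) (x : P), f x = y ∧ (∀ a x, f (s.lact a x) = lact a (f x)) ∧
      (∀ x a, f (s.ract x a) = ract (f x) a) ∧ ∀ x, coact (f x) = f.lTensor H (s.coact x)) :
    HopfBimodStr δ N where
  coact := coact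
  lact := lact
  ract := ract
  isLeftCoaction := by
    constructor <;> intro y <;> obtain ⟨f, x, rfl, -, -, hf⟩ := h y
    · have h1 (t : H ⊗[k] P) : coact.lTensor H (f.lTensor H t) =
          (f.lTensor H).lTensor H (s.coact.lTensor H t) := by
        induction t with
        | zero => simp
        | add t t' ht ht' => simp only [map_add, ht, ht']
        | tmul c x => simp [hf]
      have h3 (t : H ⊗[k] H) (x : P) : TensorProduct.assoc k H H N (t ⊗ₜ f x) =
          (f.lTensor H).lTensor H (TensorProduct.assoc k H H P (t ⊗ₜ x)) := by
        induction t with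
        | zero => simp
        | add t t' ht ht' => simp only [map_add, add_tmul, ht, ht']
        | tmul c d => simp
      have h2 (t : H ⊗[k] P) : TensorProduct.assoc k H H N
          ((Coalgebra.comul (R := k) (A := H)).rTensor N (f.lTensor H t)) =
          (f.lTensor H).lTensor H (TensorProduct.assoc k H H P
            ((Coalgebra.comul (R := k) (A := H)).rTensor P t)) := by
        induction t with
        | zero => simp
        | add t t' ht ht' => simp only [map_add, ht, ht']
        | tmul c x => simp [h3]
      rw [hf, h1, h2, s.isLeftCoaction.coassoc]
    · have h1 (t : H ⊗[k] P) : (Coalgebra.counit (R := k) (A := H)).rTensor N (f.lTensor H t) =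
          f.lTensor k ((Coalgebra.counit (R := k) (A := H)).rTensor P t) := by
        induction t with
        | zero => simp
        | add t t' ht ht' => simp only [map_add, ht, ht']
        | tmul c x => simp
      rw [hf, h1, s.isLeftCoaction.counit]
      simp
  one_lact y := by
    obtain ⟨f, x, rfl, hl, hr, hc⟩ := h y
    rw [← hl, s.one_lact]
  mul_lact a b y := by
    obtain ⟨f, x, rfl, hl, hr, hc⟩ := h y
    rw [← hl, ← hl, ← hl, s.mul_lact]
  ract_one y := by
    obtain ⟨f, x, rfl, hl, hr, hc⟩ := h y
    rw [← hr, s.ract_one]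
  ract_mul y a b := by
    obtain ⟨f, x, rfl, hl, hr, hc⟩ := h y
    rw [← hr, ← hr, ← hr, s.ract_mul]
  lact_ract a y b := by
    obtain ⟨f, x, rfl, hl, hr, hc⟩ := h y
    rw [← hl, ← hr, ← hr, ← hl, s.lact_ract]
  coact_lact a y := by
    obtain ⟨f, x, rfl, hl, hr, hc⟩ := h y
    rw [← hl, hc, hc, s.coact_lact]
    induction δ.coact a with
    | zero => simp
    | add t t' ht ht' => simp only [map_add, LinearMap.add_apply, ht, ht']
    | tmul c a =>
      induction s.coact x with
      | zero => simp
      | add t t' ht ht' => simp only [map_add, ht, ht']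
      | tmul d x => simp [hl]
  coact_ract y b := by
    obtain ⟨f, x, rfl, hl, hr, hc⟩ := h y
    rw [← hr, hc, hc, s.coact_ract]
    induction s.coact x with
    | zero => simp
    | add t t' ht ht' => simp only [map_add, LinearMap.add_apply, ht, ht']
    | tmul d x =>
      induction δ.coact b with
      | zero => simp
      | add t t' ht ht' => simp only [map_add, ht, ht']
      | tmul c a => simp [hr]

end Coend

/-! ### The universal family and the modular object. -/

section ModularObject

variable {k H A : Type u} [Field k] [Ring H] [HopfAlgebra k H] [FiniteDimensional k H]
  [Ring A] [Algebra k A] [FiniteDimensional k A] {δ : LeftComoduleAlgebra k H A}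
  {lamH : H →ₗ[k] k} {L : H} {gA gH : GroupLike k H} {α : H →ₐ[k] k} {lamA : A →ₗ[k] k}
  {ν : A ≃ₐ[k] A}

/-- The coaction of the modular object. -/
def modularCoact (δ : LeftComoduleAlgebra k H A) (gA gH : GroupLike k H) : A →ₗ[k] H ⊗[k] A :=
  (LinearMap.mulLeft k ((gA ^ (-2 : ℤ) * gH : GroupLike k H) : H)).rTensor A ∘ₗ
    δ.coact.toLinearMap

/-- The left action of `A` on the modular object. -/
def modularLact (δ : LeftComoduleAlgebra k H A) (α : H →ₐ[k] k) (ν : A ≃ₐ[k] A) :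
    A →ₗ[k] A →ₗ[k] A :=
  LinearMap.mul k A ∘ₗ ν.toLinearMap ∘ₗ ν.toLinearMap ∘ₗ
    hitRight δ.coact.toLinearMap (α.toLinearMap ∘ₗ HopfAlgebra.antipode k)

/-- The component at `X` of the universal natural family `Hom(A, X)^* → Hom(X, α)`: it is
characterized by `λ_A(y b) = ξ(τ(x b))`, where `y` is the image of `x` and `τ` the averaging
map. -/
def modularMap (hlamH : IsRightCointegral lamH) (hlam : IsGCointegral δ gA lamA)
    (h : IsFrobeniusTrace lamA) (X : HopfBimod δ) (ξ : Module.Dual k (unitObj δ ⟶ X)) :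
    X →ₗ[k] A :=
  h.toDual.symm.toLinearMap ∘ₗ X.str.ract.compr₂ (ξ ∘ₗ averageHom hlamH hlam h X)

omit [FiniteDimensional k H] in
theorem modularMap_spec (hlamH : IsRightCointegral lamH) (hlam : IsGCointegral δ gA lamA)
    (h : IsFrobeniusTrace lamA) (X : HopfBimod δ) (ξ : Module.Dual k (unitObj δ ⟶ X)) (x : X)
    (b : A) : lamA (modularMap hlamH hlam h X ξ x * b) =
      ξ (averageHom hlamH hlam h X (X.str.ract x b)) :=
  h.apply_toDual_symm _ b

omit [FiniteDimensional k H] in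
theorem modularMap_ract (hlamH : IsRightCointegral lamH) (hlam : IsGCointegral δ gA lamA)
    (h : IsFrobeniusTrace lamA) (X : HopfBimod δ) (ξ : Module.Dual k (unitObj δ ⟶ X)) (x : X)
    (b : A) : modularMap hlamH hlam h X ξ (X.str.ract x b) =
      modularMap hlamH hlam h X ξ x * b := by
  refine h.ext fun c => ?_
  rw [mul_assoc, modularMap_spec, modularMap_spec, X.str.ract_mul]

/-- With y the image of x and d = a ↼ (α ∘ S): λ_A(ν²(d) y b) = λ_A(y b ν(d)) = ξ(τ(x b ν(d))) =
ξ(τ((d ↼ α) x b)), and d ↼ α = a. -/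
theorem modularMap_lact (hlamH : IsRightCointegral lamH) (hlamH0 : lamH ≠ 0)
    (hL : IsLeftIntegral (k := k) L) (hL0 : L ≠ 0) (hα : IsLeftModularFunction L α)
    (hlam : IsGCointegral δ gA lamA) (h : IsFrobeniusTrace lamA)
    (hν : IsNakayamaAutomorphism lamA ν) (X : HopfBimod δ)
    (ξ : Module.Dual k (unitObj δ ⟶ X)) (a : A) (x : X) :
    modularMap hlamH hlam h X ξ (X.str.lact a x) =
      modularLact δ α ν a (modularMap hlamH hlam h X ξ x) := by
  refine h.ext fun b => ?_
  set d := hitRight δ.coact.toLinearMap (α.toLinearMap ∘ₗ HopfAlgebra.antipode k) a with hd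
  have h1 : modularLact δ α ν a (modularMap hlamH hlam h X ξ x) =
      ν (ν d) * modularMap hlamH hlam h X ξ x := rfl
  rw [h1, mul_assoc, ← hν (ν d), mul_assoc, modularMap_spec, modularMap_spec]
  congr 1
  refine unit_hom_ext ?_
  refine (toLin_averageHom hlamH hlam h X _).trans
    (Eq.trans ?_ (toLin_averageHom hlamH hlam h X _).symm)
  rw [X.str.ract_mul, average_ract_nakayama hlamH hlamH0 hL hL0 hα hlam h hν, hd,
    hitRight_antipode_hitRight δ.isLeftCoaction, X.str.lact_ract]

-- Evaluation at 1 embeds Hom(A, X) in X and stays injective after tensoring with H, so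
-- `lTensor_average` lifts to morphisms.
omit [FiniteDimensional k H] in
theorem lTensor_averageHom (hlamH : IsRightCointegral lamH)
    (hg : IsDistinguishedGrouplike lamH gH) (hlam : IsGCointegral δ gA lamA)
    (h : IsFrobeniusTrace lamA) (X : HopfBimod δ) (x : X) :
    (averageHom hlamH hlam h X).lTensor H (X.str.coact x) =
      ((gA⁻¹ * gH : GroupLike k H) : H) ⊗ₜ averageHom hlamH hlam h X x := by
  let ev : (unitObj δ ⟶ X) →ₗ[k] X :=
    { toFun := fun f => HopfBimod.toLin f (1 : A)
      map_add' := fun f f' => rfl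
      map_smul' := fun c f => rfl }
  have hev : Function.Injective ev := fun f f' hff' => unit_hom_ext hff'
  have h1 : ev ∘ₗ averageHom hlamH hlam h X = average lamH gA h X :=
    LinearMap.ext fun x => toLin_averageHom hlamH hlam h X x
  apply Module.Flat.lTensor_preserves_injective_linearMap ev hev
  rw [← LinearMap.comp_apply, ← LinearMap.lTensor_comp, h1, lTensor_average hg,
    LinearMap.lTensor_tmul, ← h1]
  rfl

/-- Both sides are tested against δ(b) through λ_A. The left side gives g_A⁻² g_H g_A λ_A(y b) as
λ_A is a g_A-cointegral, the right side g_A⁻¹ g_H ξ(τ(x b)); they agree because g_A and g_H commute.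
-/
theorem coact_modularMap (hlamH : IsRightCointegral lamH) (hlamH0 : lamH ≠ 0)
    (hL : IsLeftIntegral (k := k) L) (hL0 : L ≠ 0) (hg : IsDistinguishedGrouplike lamH gH)
    (hlam : IsGCointegral δ gA lamA) (h : IsFrobeniusTrace lamA) (X : HopfBimod δ)
    (ξ : Module.Dual k (unitObj δ ⟶ X)) (x : X) :
    modularCoact δ gA gH (modularMap hlamH hlam h X ξ x) =
      (modularMap hlamH hlam h X ξ).lTensor H (X.str.coact x) := by
  refine tensor_ext_coact (δ := δ) (antipode_injective hlamH hlamH0 hL hL0) h fun b => ?_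
  have hcomm := hg.commute hlamH hlamH0 hL hL0 gA
  have hgrp : gA ^ (-2 : ℤ) * gH * gA = gA⁻¹ * gH := by
    rw [mul_assoc, ← hcomm, ← mul_assoc, zpow_neg, zpow_two]
    group
  set y := modularMap hlamH hlam h X ξ x with hy
  have h1 (s t : H ⊗[k] A) (c : H) : TensorProduct.rid k H (lamA.lTensor H
      ((LinearMap.mulLeft k c).rTensor A s * t)) =
      c * TensorProduct.rid k H (lamA.lTensor H (s * t)) := by
    induction s with
    | zero => simp
    | add s s' hs hs' => simp only [map_add, add_mul, mul_add, hs, hs']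
    | tmul d a =>
      induction t with
      | zero => simp
      | add t t' ht ht' => simp only [map_add, mul_add, ht, ht']
      | tmul e a' => simp [mul_assoc]
  have h2 (s : H ⊗[k] X) (t : H ⊗[k] A) : TensorProduct.rid k H (lamA.lTensor H
      ((modularMap hlamH hlam h X ξ).lTensor H s * t)) =
      TensorProduct.rid k H (ξ.lTensor H ((averageHom hlamH hlam h X).lTensor H
        (TensorProduct.map₂ (LinearMap.mul k H) X.str.ract s t))) := by
    induction s with
    | zero => simp
    | add s s' hs hs' => simp only [map_add, add_mul, LinearMap.add_apply, hs, hs']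
    | tmul d a =>
      induction t with
      | zero => simp
      | add t t' ht ht' => simp only [map_add, mul_add, ht, ht']
      | tmul e a' => simp [modularMap_spec]
  have h3 : TensorProduct.rid k H (lamA.lTensor H (modularCoact δ gA gH y * δ.coact b)) =
      lamA (y * b) • ((gA ^ (-2 : ℤ) * gH * gA : GroupLike k H) : H) := by
    refine (h1 _ _ _).trans ?_
    rw [AlgHom.toLinearMap_apply, ← map_mul, hlam, mul_smul_comm]
    rfl
  rw [h3, h2, ← X.str.coact_ract, lTensor_averageHom hlamH hg, hgrp, hy, modularMap_spec]
  simp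

/-- The map is the composite Hom(A, P)^* ≅ A^* ≅ A of the transpose of b ↦ τ(p b) with the inverse
of the Frobenius isomorphism. -/
theorem modularMap_bijective (hlamH : IsRightCointegral lamH) (hlamH0 : lamH ≠ 0)
    (hL : IsLeftIntegral (k := k) L) (hL0 : L ≠ 0) (hα : IsLeftModularFunction L α)
    (hlam : IsGCointegral δ gA lamA) (h : IsFrobeniusTrace lamA) :
    Function.Bijective fun ξ : Module.Dual k (unitObj δ ⟶ generator δ) =>
      modularMap hlamH hlam h (generator δ) ξ (generatorElt δ L) := by
  have hT := averageHom_generator_bijective hlamH hlamH0 hL hL0 hα hlam h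
  let T : A ≃ₗ[k] (unitObj δ ⟶ generator δ) := LinearEquiv.ofBijective
    (averageHom hlamH hlam h (generator δ) ∘ₗ (generator δ).str.ract (generatorElt δ L)) hT
  constructor
  · intro ξ ξ' hξ
    refine LinearMap.ext fun f => ?_
    obtain ⟨b, rfl⟩ := hT.2 f
    have h1 := congrArg (fun y => lamA (y * b)) hξ
    simpa only [modularMap_spec] using h1
  · intro y
    refine ⟨(lamA ∘ₗ LinearMap.mulLeft k y) ∘ₗ T.symm.toLinearMap, h.ext fun b => ?_⟩
    rw [modularMap_spec]
    exact congrArg (fun c => lamA (y * c)) (T.symm_apply_apply b)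

/-- The structure of a relative Hopf bimodule of the modular object. -/
def modularStr (hlamH : IsRightCointegral lamH) (hlamH0 : lamH ≠ 0)
    (hL : IsLeftIntegral (k := k) L) (hL0 : L ≠ 0) (hg : IsDistinguishedGrouplike lamH gH)
    (hα : IsLeftModularFunction L α) (hlam : IsGCointegral δ gA lamA) (h : IsFrobeniusTrace lamA)
    (hν : IsNakayamaAutomorphism lamA ν) : HopfBimodStr δ A :=
  (generator δ).str.ofSurjective (modularCoact δ gA gH) (modularLact δ α ν) (LinearMap.mul k A)
    fun y => by
      obtain ⟨ξ, hξ⟩ := (modularMap_bijective hlamH hlamH0 hL hL0 hα hlam h).2 y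
      exact ⟨modularMap hlamH hlam h (generator δ) ξ, generatorElt δ L, hξ,
        modularMap_lact hlamH hlamH0 hL hL0 hα hlam h hν _ ξ,
        modularMap_ract hlamH hlam h _ ξ,
        coact_modularMap hlamH hlamH0 hL hL0 hg hlam h _ ξ⟩

theorem isModularObject_modularStr (hlamH : IsRightCointegral lamH) (hlamH0 : lamH ≠ 0)
    (hL : IsLeftIntegral (k := k) L) (hL0 : L ≠ 0) (hg : IsDistinguishedGrouplike lamH gH)
    (hα : IsLeftModularFunction L α) (hlam : IsGCointegral δ gA lamA) (h : IsFrobeniusTrace lamA)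
    (hν : IsNakayamaAutomorphism lamA ν) :
    IsModularObject δ { carrier := A,
                        str := modularStr hlamH hlamH0 hL hL0 hg hα hlam h hν } := by
  let N : HopfBimod δ := { carrier := A, str := modularStr hlamH hlamH0 hL hL0 hg hα hlam h hν }
  let π (X : HopfBimod δ) : Module.Dual k (unitObj δ ⟶ X) →ₗ[k] (X ⟶ N) :=
    { toFun := fun ξ => ⟨modularMap hlamH hlam h X ξ,
        modularMap_lact hlamH hlamH0 hL hL0 hα hlam h hν X ξ,
        modularMap_ract hlamH hlam h X ξ,
        coact_modularMap hlamH hlamH0 hL hL0 hg hlam h X ξ⟩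
      map_add' := fun ξ ξ' => HopfBimod.hom_ext (LinearMap.ext fun x => h.ext fun b => by
        change lamA (modularMap hlamH hlam h X (ξ + ξ') x * b) =
          lamA ((modularMap hlamH hlam h X ξ x + modularMap hlamH hlam h X ξ' x) * b)
        simp only [add_mul, map_add, modularMap_spec, LinearMap.add_apply])
      map_smul' := fun c ξ => HopfBimod.hom_ext (LinearMap.ext fun x => h.ext fun b => by
        change lamA (modularMap hlamH hlam h X (c • ξ) x * b) =
          lamA ((c • modularMap hlamH hlam h X ξ x) * b)
        simp only [smul_mul_assoc, map_smul, modularMap_spec, LinearMap.smul_apply]) }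
  have hπ : HopfBimod.IsNaturalFamily π := by
    intro X Y f ξ
    refine HopfBimod.hom_ext (LinearMap.ext fun x => h.ext fun b => ?_)
    change lamA (modularMap hlamH hlam h X _ x * b) =
      lamA (modularMap hlamH hlam h Y ξ (HopfBimod.toLin f x) * b)
    rw [modularMap_spec, modularMap_spec]
    change ξ (averageHom hlamH hlam h X (X.str.ract x b) ≫ f) = _
    rw [averageHom_naturality]
    exact congrArg (fun y => ξ (averageHom hlamH hlam h Y y)) (f.2.2.1 x b)
  exact hπ.isNakayama (exists_hom_generator hlamH hlamH0 hL hL0)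
    (modularMap_bijective hlamH hlamH0 hL hL0 hα hlam h)

end ModularObject

end

/-- `g_H`, `α_H` and `ν_A` are uniquely determined by the first three conjuncts. -/
theorem mainTheorem9 {k H A : Type u} [Field k] [Ring H] [HopfAlgebra k H] [FiniteDimensional k H]
    [Ring A] [Algebra k A] [FiniteDimensional k A] (δ : LeftComoduleAlgebra k H A)
    (lamH : H →ₗ[k] k) (hlamH : IsRightCointegral lamH) (hlamH0 : lamH ≠ 0)
    (L : H) (hL : IsLeftIntegral (k := k) L) (hL0 : L ≠ 0)
    (gA : GroupLike k H) (lamA : A →ₗ[k] k) (hlamA : IsGCointegral δ gA lamA)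
    (hlamA' : IsFrobeniusTrace lamA) :
    ∃ (gH : GroupLike k H) (αH : H →ₐ[k] k) (νA : A ≃ₐ[k] A),
      IsDistinguishedGrouplike lamH gH ∧
      IsLeftModularFunction L αH ∧
      IsNakayamaAutomorphism lamA νA ∧
      ∃ s : HopfBimodStr δ A,
        (∀ x : A, s.coact x =
          (LinearMap.mulLeft k ((gA ^ (-2 : ℤ) * gH : GroupLike k H) : H)).rTensor A
            (δ.coact x)) ∧
        (∀ a x : A, s.lact a x =
          νA (νA (hitRight δ.coact.toLinearMap (αH.toLinearMap ∘ₗ HopfAlgebra.antipode k) a)) * x) ∧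
        (∀ x b : A, s.ract x b = x * b) ∧
        IsModularObject δ { carrier := A, str := s } := by
  obtain ⟨gH, hg⟩ := exists_distinguishedGrouplike hlamH hlamH0 hL hL0
  obtain ⟨αH, hα⟩ := exists_leftModularFunction hlamH hlamH0 hL hL0
  obtain ⟨νA, hν⟩ := hlamA'.exists_nakayama
  exact ⟨gH, αH, νA, hg, hα, hν, modularStr hlamH hlamH0 hL hL0 hg hα hlamA hlamA' hν,
    fun _ => rfl, fun _ _ => rfl, fun _ _ => rfl,
    isModularObject_modularStr hlamH hlamH0 hL hL0 hg hα hlamA hlamA' hν⟩
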